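/- Let $\mathbb H$ be the quaternions, $\mathbb B$ its open unit ball, $I\in\mathbb H$ with $I^2=-1$, $\mathbb C_I=\{x+yI: x,y\in\mathbb R\}$ and $\mathbb T_I=\partial\mathbb B\cap\mathbb C_I$. A function $f:\mathbb B\to\mathbb H$ is slice regular if \[f(x+yJ)=\tfrac12\big(f(x+yK)+f(x-yK)\big)+\tfrac{JK}{2}\big(f(x-yK)-f(x+yK)\big)\] for all $J,K\in\mathbb H$ with $J^2=K^2=-1$ and all real $x,y$ with $x^2+y^2<1$, and if for each such $J$ the restriction $f_J$ of $f$ to $\mathbb B\cap\mathbb C_J$ has continuous partial derivatives with $\tfrac12(\partial_x+J\partial_y)f_J(x+yJ)=0$. Let $H^2(\mathbb B_I)$ be the right $\mathbb H$-module of all slice regular $f:\mathbb B\to\mathbb H$ with \[\|f_I\|^2:=\sup_{0\le r<1}\frac1{2\pi}\int_0^{2\pi}|f_I(re^{It})|^2\,dt<\infty .\] Let $L^2(\mathbb T_I)$ be the right $\mathbb H$-module of measurable $g:\mathbb T_I\to\mathbb H$, modulo equality almost everywhere, with $\|g\|^2:=\frac1{2\pi}\int_0^{2\pi}|g(e^{It})|^2dt<\infty$,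 and let $H^2_+(\mathbb T_I)$ be its submodule of all $g(e^{It})=\sum_{k=0}^\infty e^{Ikt}a_k$ (convergence in $L^2(\mathbb T_I)$) with $a_k\in\mathbb H$ and $\sum_{k=0}^\infty|a_k|^2<\infty$. Theorem. For every $f\in H^2(\mathbb B_I)$ the radial limit $\hat f_I(e^{It}):=\lim_{r\to1^-}f_I(re^{It})$ exists at almost every point of $\mathbb T_I$. Furthermore, $f\mapsto\hat f_I$ is an isometric isomorphism of right $\mathbb H$-modules from $H^2(\mathbb B_I)$, with the norm $\|f_I\|$, onto $H^2_+(\mathbb T_I)$, with the norm of $L^2(\mathbb T_I)$: it is well defined, right $\mathbb H$-linear, bijective, and $\|\hat f_I\|=\|f_I\|$ for all $f$. -/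

import Mathlib

open MeasureTheory Filter Topology
open scoped Quaternion ENNReal

namespace SliceHardy

noncomputable section

/-- The real quaternions carry their Borel sigma-algebra. -/
instance instMeasurableSpaceQuaternion : MeasurableSpace ℍ[ℝ] := borel ℍ[ℝ]

instance instBorelSpaceQuaternion : BorelSpace ℍ[ℝ] := ⟨rfl⟩

/-- The set `𝕊` of imaginary units of the quaternions. -/
def imagUnits : Set ℍ[ℝ] := {q | q ^ 2 = -1}

/-- The point `x + y I`. -/
def slicePt (I : ℍ[ℝ]) (x y : ℝ) : ℍ[ℝ] := (x : ℍ[ℝ]) + (y : ℍ[ℝ]) * I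

/-- The complex slice `ℂ_I = {x + y I : x, y ∈ ℝ}`. -/
def slicePlane (I : ℍ[ℝ]) : Set ℍ[ℝ] := {q | ∃ x y : ℝ, q = slicePt I x y}

/-- The point `e^{It} = cos t + sin t I`. -/
def expUnit (I : ℍ[ℝ]) (t : ℝ) : ℍ[ℝ] := slicePt I (Real.cos t) (Real.sin t)

/-- The open unit ball `𝔹` of the quaternions. -/
abbrev unitBall : Set ℍ[ℝ] := Metric.ball 0 1

/-- The circle `𝕋_I = ∂𝔹 ∩ ℂ_I`. -/
def sliceCircle (I : ℍ[ℝ]) : Set ℍ[ℝ] := Metric.sphere 0 1 ∩ slicePlane I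

/-! ### Slice regular functions -/

/-- `f` is a slice function on `Ω`. -/
def IsSliceOn (f : ℍ[ℝ] → ℍ[ℝ]) (Ω : Set ℍ[ℝ]) : Prop :=
  ∀ I ∈ imagUnits, ∀ J ∈ imagUnits, ∀ x y : ℝ,
    slicePt I x y ∈ Ω → slicePt I x (-y) ∈ Ω → slicePt J x y ∈ Ω →
      f (slicePt J x y) =
        (1 / 2) * (f (slicePt I x y) + f (slicePt I x (-y))) +
          (J * I / 2) * (f (slicePt I x (-y)) - f (slicePt I x y))

/-- The restriction `f_I` in the real coordinates `(x, y)` of `ℂ_I`. -/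
def sliceRestr (f : ℍ[ℝ] → ℍ[ℝ]) (I : ℍ[ℝ]) (p : ℝ × ℝ) : ℍ[ℝ] := f (slicePt I p.1 p.2)

/-- The set `Ω_I = Ω ∩ ℂ_I` in the real coordinates `(x, y)` of `ℂ_I`. -/
def sliceDom (Ω : Set ℍ[ℝ]) (I : ℍ[ℝ]) : Set (ℝ × ℝ) := {p | slicePt I p.1 p.2 ∈ Ω}

/-- For `Ω` open: `f_I` is continuously differentiable on `Ω_I` and
`½ (∂_x + I ∂_y) f_I = 0` there. -/
def IsSliceHolomorphicOn (f : ℍ[ℝ] → ℍ[ℝ]) (Ω : Set ℍ[ℝ]) (I : ℍ[ℝ]) : Prop :=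
  ContDiffOn ℝ 1 (sliceRestr f I) (sliceDom Ω I) ∧
    ∀ p ∈ sliceDom Ω I,
      (1 / 2) * (fderiv ℝ (sliceRestr f I) p (1, 0) +
        I * fderiv ℝ (sliceRestr f I) p (0, 1)) = 0

/-- `f` is a slice (left) regular function on the open set `Ω`. -/
def IsSliceRegularOn (f : ℍ[ℝ] → ℍ[ℝ]) (Ω : Set ℍ[ℝ]) : Prop :=
  IsSliceOn f Ω ∧ ∀ I ∈ imagUnits, IsSliceHolomorphicOn f Ω I

/-- Extension by zero of a function on the unit ball; only its values in the ball are ever used. -/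
def ext0 (f : unitBall → ℍ[ℝ]) (q : ℍ[ℝ]) : ℍ[ℝ] :=
  open Classical in if h : q ∈ unitBall then f ⟨q, h⟩ else 0

/-! ### The space `H²(𝔹_I)` -/

/-- `‖f_I‖² = sup_{0 ≤ r < 1} (1/2π) ∫_0^{2π} |f_I(r e^{It})|² dt`, with values in `[0, ∞]`. -/
def hardyNormSq (I : ℍ[ℝ]) (f : unitBall → ℍ[ℝ]) : ℝ≥0∞ :=
  ⨆ r ∈ Set.Ico (0 : ℝ) 1, ENNReal.ofReal (1 / (2 * Real.pi)) *
    ∫⁻ t in Set.Ioc 0 (2 * Real.pi), ‖ext0 f (r • expUnit I t)‖ₑ ^ 2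

/-- The norm `‖f_I‖`. -/
def hardyNorm (I : ℍ[ℝ]) (f : unitBall → ℍ[ℝ]) : ℝ := Real.sqrt (hardyNormSq I f).toReal

lemma ext0_add (f g : unitBall → ℍ[ℝ]) : ext0 (f + g) = ext0 f + ext0 g := by
  funext q
  by_cases h : q ∈ unitBall <;> simp [ext0, h]

lemma ext0_smul (c : ℍ[ℝ]ᵐᵒᵖ) (f : unitBall → ℍ[ℝ]) : ext0 (c • f) = c • ext0 f := by
  funext q
  by_cases h : q ∈ unitBall <;> simp [ext0, h]

lemma ext0_zero : ext0 0 = 0 := by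
  funext q
  simp [ext0]

lemma continuous_slicePt (I : ℍ[ℝ]) : Continuous fun p : ℝ × ℝ => slicePt I p.1 p.2 := by
  unfold slicePt
  have := Quaternion.continuous_coe
  fun_prop

lemma isOpen_sliceDom (I : ℍ[ℝ]) : IsOpen (sliceDom unitBall I) :=
  Metric.isOpen_ball.preimage (continuous_slicePt I)

lemma continuous_expUnit (I : ℍ[ℝ]) : Continuous (expUnit I) :=
  (continuous_slicePt I).comp (Real.continuous_cos.prodMk Real.continuous_sin)

lemma norm_slicePt {I : ℍ[ℝ]} (hI : I ∈ imagUnits) (x y : ℝ) :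
    ‖slicePt I x y‖ ^ 2 = x ^ 2 + y ^ 2 := by
  have h : I ^ 2 = -1 := hI
  have hn : ‖I‖ = 1 := by
    have h2 : ‖I‖ ^ 2 = 1 := by rw [← norm_pow, h, norm_neg, norm_one]
    nlinarith [norm_nonneg I, sq_nonneg (‖I‖ - 1), sq_nonneg (‖I‖ + 1)]
  have hns : I.re ^ 2 + I.imI ^ 2 + I.imJ ^ 2 + I.imK ^ 2 = 1 := by
    rw [← Quaternion.normSq_def', Quaternion.normSq_eq_norm_mul_self, hn, one_mul]
  have hre : I.re = 0 := by
    have h0 := congrArg (fun q : ℍ[ℝ] => q.re) h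
    simp [pow_two] at h0
    nlinarith [h0, hns]
  rw [pow_two, ← Quaternion.normSq_eq_norm_mul_self, Quaternion.normSq_def']
  simp [slicePt, hre] at hns ⊢
  linear_combination y ^ 2 * hns

lemma norm_expUnit {I : ℍ[ℝ]} (hI : I ∈ imagUnits) (t : ℝ) : ‖expUnit I t‖ = 1 := by
  have h := norm_slicePt hI (Real.cos t) (Real.sin t)
  rw [Real.cos_sq_add_sin_sq] at h
  exact (pow_eq_one_iff_of_nonneg (norm_nonneg _) two_ne_zero).1 h

lemma expUnit_mem {I : ℍ[ℝ]} (hI : I ∈ imagUnits) (t : ℝ) : expUnit I t ∈ sliceCircle I :=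
  ⟨by simpa using norm_expUnit hI t, _, _, rfl⟩

lemma smul_expUnit (I : ℍ[ℝ]) (r t : ℝ) :
    r • expUnit I t = slicePt I (r * Real.cos t) (r * Real.sin t) := by
  simp only [expUnit, slicePt, smul_add, ← Quaternion.coe_mul_eq_smul, Quaternion.coe_mul,
    mul_assoc]

lemma IsSliceHolomorphicOn.continuous_circle {f : ℍ[ℝ] → ℍ[ℝ]} {I : ℍ[ℝ]} (hI : I ∈ imagUnits)
    (hf : IsSliceHolomorphicOn f unitBall I) {r : ℝ} (hr : r ∈ Set.Ico (0 : ℝ) 1) :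
    Continuous fun t : ℝ => f (r • expUnit I t) := by
  have h : Continuous (sliceRestr f I ∘ fun t : ℝ => (r * Real.cos t, r * Real.sin t)) := by
    refine hf.1.continuousOn.comp_continuous (by fun_prop) fun t => ?_
    show slicePt I (r * Real.cos t) (r * Real.sin t) ∈ unitBall
    rw [← smul_expUnit, mem_ball_zero_iff, norm_smul, norm_expUnit hI, mul_one,
      Real.norm_of_nonneg hr.1]
    exact hr.2
  exact h.congr fun t => by rw [smul_expUnit]; rfl

lemma IsSliceRegularOn.add {f g : ℍ[ℝ] → ℍ[ℝ]} (hf : IsSliceRegularOn f unitBall)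
    (hg : IsSliceRegularOn g unitBall) : IsSliceRegularOn (f + g) unitBall := by
  refine ⟨fun I hI J hJ x y h1 h2 h3 => ?_, fun I hI => ⟨?_, fun p hp => ?_⟩⟩
  · simp only [Pi.add_apply]
    rw [hf.1 I hI J hJ x y h1 h2 h3, hg.1 I hI J hJ x y h1 h2 h3]
    noncomm_ring
  · exact (hf.2 I hI).1.add (hg.2 I hI).1
  · have hD := (isOpen_sliceDom I).mem_nhds hp
    have e : sliceRestr (f + g) I = sliceRestr f I + sliceRestr g I := rfl
    rw [e, fderiv_add (((hf.2 I hI).1.contDiffAt hD).differentiableAt one_ne_zero)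
      (((hg.2 I hI).1.contDiffAt hD).differentiableAt one_ne_zero)]
    have a := (hf.2 I hI).2 p hp
    have b := (hg.2 I hI).2 p hp
    simp only [add_apply]
    have ab := congrArg₂ (· + ·) a b
    simp only [mul_add, add_zero] at ab ⊢
    rw [← ab]
    abel

lemma IsSliceRegularOn.smul {f : ℍ[ℝ] → ℍ[ℝ]} (hf : IsSliceRegularOn f unitBall)
    (c : ℍ[ℝ]ᵐᵒᵖ) : IsSliceRegularOn (c • f) unitBall := by
  refine ⟨fun I hI J hJ x y h1 h2 h3 => ?_, fun I hI => ⟨?_, fun p hp => ?_⟩⟩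
  · simp only [Pi.smul_apply, MulOpposite.smul_eq_mul_unop]
    rw [hf.1 I hI J hJ x y h1 h2 h3]
    simp only [add_mul, sub_mul, mul_add, mul_sub, mul_assoc]
  · exact (hf.2 I hI).1.mul contDiffOn_const
  · have hD := (isOpen_sliceDom I).mem_nhds hp
    have e : sliceRestr (c • f) I = fun p => sliceRestr f I p * c.unop := rfl
    rw [e, fderiv_mul_const' (((hf.2 I hI).1.contDiffAt hD).differentiableAt one_ne_zero)]
    have a := (hf.2 I hI).2 p hp
    simp only [smul_apply, MulOpposite.smul_eq_mul_unop, MulOpposite.unop_op]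
    rw [← mul_assoc I, ← add_mul, ← mul_assoc, a, zero_mul]

lemma isSliceRegularOn_zero : IsSliceRegularOn 0 unitBall := by
  refine ⟨fun I hI J hJ x y h1 h2 h3 => by simp, fun I hI => ⟨contDiffOn_const, fun p hp => ?_⟩⟩
  have e : sliceRestr 0 I = fun _ => 0 := rfl
  simp [e]

lemma hardyNormSq_add_le {I : ℍ[ℝ]} (hI : I ∈ imagUnits) {f g : unitBall → ℍ[ℝ]}
    (hf : IsSliceRegularOn (ext0 f) unitBall) :
    hardyNormSq I (f + g) ≤ 2 * (hardyNormSq I f + hardyNormSq I g) := by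
  refine iSup₂_le fun r hr => ?_
  have hm : Measurable fun t : ℝ => ‖ext0 f (r • expUnit I t)‖ₑ ^ 2 :=
    (((hf.2 I hI).continuous_circle hI hr).enorm.measurable).pow_const 2
  have key : ∀ a b : ℝ≥0∞, (a + b) ^ 2 ≤ 2 * (a ^ 2 + b ^ 2) := by
    intro a b
    have := ENNReal.rpow_add_le_mul_rpow_add_rpow a b (p := 2) (by norm_num)
    norm_num at this
    exact_mod_cast this
  calc _ ≤ ENNReal.ofReal (1 / (2 * Real.pi)) * ∫⁻ t in Set.Ioc 0 (2 * Real.pi),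
          2 * (‖ext0 f (r • expUnit I t)‖ₑ ^ 2 + ‖ext0 g (r • expUnit I t)‖ₑ ^ 2) := by
        gcongr with t
        rw [ext0_add]
        exact (pow_le_pow_left' (enorm_add_le _ _) 2).trans (key _ _)
    _ = 2 * (ENNReal.ofReal (1 / (2 * Real.pi)) * (∫⁻ t in Set.Ioc 0 (2 * Real.pi),
          ‖ext0 f (r • expUnit I t)‖ₑ ^ 2) + ENNReal.ofReal (1 / (2 * Real.pi)) *
          ∫⁻ t in Set.Ioc 0 (2 * Real.pi), ‖ext0 g (r • expUnit I t)‖ₑ ^ 2) := by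
        rw [lintegral_const_mul' _ _ (by simp), lintegral_add_left hm]
        ring
    _ ≤ _ := by
        gcongr
        · exact le_iSup₂ (f := fun (r : ℝ) (_ : r ∈ Set.Ico (0 : ℝ) 1) =>
            ENNReal.ofReal (1 / (2 * Real.pi)) *
              ∫⁻ t in Set.Ioc 0 (2 * Real.pi), ‖ext0 f (r • expUnit I t)‖ₑ ^ 2) r hr
        · exact le_iSup₂ (f := fun (r : ℝ) (_ : r ∈ Set.Ico (0 : ℝ) 1) =>
            ENNReal.ofReal (1 / (2 * Real.pi)) *
              ∫⁻ t in Set.Ioc 0 (2 * Real.pi), ‖ext0 g (r • expUnit I t)‖ₑ ^ 2) r hr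

lemma hardyNormSq_smul (I : ℍ[ℝ]) (c : ℍ[ℝ]ᵐᵒᵖ) (f : unitBall → ℍ[ℝ]) :
    hardyNormSq I (c • f) = ‖c.unop‖ₑ ^ 2 * hardyNormSq I f := by
  simp only [hardyNormSq, ENNReal.mul_iSup]
  refine iSup_congr fun r => iSup_congr fun hr => ?_
  rw [mul_left_comm, ← lintegral_const_mul' (‖c.unop‖ₑ ^ 2) _ (by simp)]
  congr 1
  refine lintegral_congr fun t => ?_
  rw [ext0_smul, Pi.smul_apply, MulOpposite.smul_eq_mul_unop, enorm_mul, mul_pow, mul_comm]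

/-- The right `ℍ`-module `H²(𝔹_I)` of the slice regular functions `f` on `𝔹` with `‖f_I‖ < ∞`. -/
def hardyBall (I : imagUnits) : Submodule ℍ[ℝ]ᵐᵒᵖ (unitBall → ℍ[ℝ]) where
  carrier := {f | IsSliceRegularOn (ext0 f) unitBall ∧ hardyNormSq I f < ∞}
  add_mem' {f g} hf hg := by
    refine ⟨by rw [ext0_add]; exact hf.1.add hg.1, ?_⟩
    exact (hardyNormSq_add_le I.2 hf.1).trans_lt
      (ENNReal.mul_lt_top (by simp) (ENNReal.add_lt_top.2 ⟨hf.2, hg.2⟩))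
  zero_mem' := ⟨by rw [ext0_zero]; exact isSliceRegularOn_zero, by simp [hardyNormSq, ext0_zero]⟩
  smul_mem' c f hf := by
    refine ⟨by rw [ext0_smul]; exact hf.1.smul c, ?_⟩
    rw [hardyNormSq_smul]
    exact ENNReal.mul_lt_top (by simp) hf.2

/-! ### The spaces `L²(𝕋_I)` and `H²₊(𝕋_I)` -/

/-- The parametrization `t ↦ e^{It}` of the circle `𝕋_I`. -/
def circleParam (I : imagUnits) (t : ℝ) : sliceCircle (I : ℍ[ℝ]) :=
  ⟨expUnit I t, expUnit_mem I.2 t⟩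

/-- The normalized arc length measure `dt / 2π` on `𝕋_I`. -/
def arcMeasure (I : imagUnits) : Measure (sliceCircle (I : ℍ[ℝ])) :=
  ENNReal.ofReal (1 / (2 * Real.pi)) •
    (volume.restrict (Set.Ioc 0 (2 * Real.pi))).map (circleParam I)

lemma continuous_circleParam (I : imagUnits) : Continuous (circleParam I) :=
  (continuous_expUnit I).subtype_mk _

instance instIsProbabilityMeasureArcMeasure (I : imagUnits) :
    IsProbabilityMeasure (arcMeasure I) := by
  constructor
  rw [arcMeasure, Measure.smul_apply,
    Measure.map_apply (continuous_circleParam I).measurable MeasurableSet.univ]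
  simp only [Set.preimage_univ, Measure.restrict_apply_univ, Real.volume_Ioc, sub_zero, smul_eq_mul]
  rw [← ENNReal.ofReal_mul (by positivity), one_div_mul_cancel (by positivity), ENNReal.ofReal_one]

/-- The space `L²(𝕋_I)` of square integrable functions `𝕋_I → ℍ` modulo equality a.e. -/
abbrev L2Circle (I : imagUnits) := Lp ℍ[ℝ] 2 (arcMeasure I)

lemma memLp_monomial (I : imagUnits) (k : ℕ) (a : ℍ[ℝ]) :
    MemLp (fun ζ : sliceCircle (I : ℍ[ℝ]) => (ζ : ℍ[ℝ]) ^ k * a) 2 (arcMeasure I) := by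
  refine MemLp.of_bound (C := ‖a‖) (Continuous.aestronglyMeasurable (by fun_prop))
    (Eventually.of_forall fun ζ => ?_)
  have h : ‖(ζ : ℍ[ℝ])‖ = 1 := by simpa using ζ.2.1
  simp [h]

/-- The function `e^{It} ↦ e^{Ikt} a` as an element of `L²(𝕋_I)`. -/
def monomial (I : imagUnits) (k : ℕ) (a : ℍ[ℝ]) : L2Circle I := (memLp_monomial I k a).toLp _

lemma monomial_add (I : imagUnits) (k : ℕ) (a b : ℍ[ℝ]) :
    monomial I k (a + b) = monomial I k a + monomial I k b := by
  rw [monomial, monomial, monomial, ← MemLp.toLp_add]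
  congr 1
  funext ζ
  simp [mul_add]

lemma monomial_smul (I : imagUnits) (k : ℕ) (c : ℍ[ℝ]ᵐᵒᵖ) (a : ℍ[ℝ]) :
    monomial I k (c • a) = c • monomial I k a := by
  rw [monomial, monomial, ← MemLp.toLp_const_smul]
  congr 1
  funext ζ
  simp [mul_assoc]

/-- The right `ℍ`-module `H²₊(𝕋_I)` of all `∑_{k ≥ 0} e^{Ikt} a_k` (convergence in `L²(𝕋_I)`) with
`a_k ∈ ℍ` and `∑ |a_k|² < ∞`. -/
def hardyCircle (I : imagUnits) : Submodule ℍ[ℝ]ᵐᵒᵖ (L2Circle I) where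
  carrier := {g | ∃ a : ℕ → ℍ[ℝ], (Summable fun k => ‖a k‖ ^ 2) ∧
    HasSum (fun k => monomial I k (a k)) g}
  add_mem' := by
    rintro f g ⟨a, ha, haf⟩ ⟨b, hb, hbg⟩
    refine ⟨a + b, ?_, ?_⟩
    · refine Summable.of_nonneg_of_le (fun k => by positivity) (fun k => ?_)
        ((ha.add hb).mul_left 2)
      have := norm_add_le (a k) (b k)
      have h0 := norm_nonneg (a k + b k)
      simp only [Pi.add_apply]
      nlinarith [sq_nonneg (‖a k‖ - ‖b k‖)]
    · simpa only [Pi.add_apply, monomial_add] using haf.add hbg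
  zero_mem' := by
    refine ⟨0, by simp, ?_⟩
    have h : ∀ k, monomial I k 0 = 0 := fun k => by
      simpa using monomial_smul I k 0 0
    simp [h]
  smul_mem' := by
    rintro c f ⟨a, ha, haf⟩
    refine ⟨c • a, ?_, ?_⟩
    · simpa [MulOpposite.smul_eq_mul_unop, mul_pow] using ha.mul_right (‖c.unop‖ ^ 2)
    · simpa only [Pi.smul_apply, monomial_smul] using haf.const_smul c

/-- `L` is the radial limit `lim_{r → 1⁻} f_I(r ζ)` at the point `ζ` of `𝕋_I`. -/
def HasRadialLimit {I : imagUnits} (f : unitBall → ℍ[ℝ]) (ζ : sliceCircle (I : ℍ[ℝ]))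
    (L : ℍ[ℝ]) : Prop :=
  Tendsto (fun r : ℝ => ext0 f (r • (ζ : ℍ[ℝ]))) (𝓝[<] 1) (𝓝 L)

end

end SliceHardy

/-!
Left multiplication by `x + y I` makes `ℍ` a complex Banach space (`sliceNormedSpace`), and on the
slice `ℂ_I` a slice regular function is a holomorphic function of `z = x + y i` with values in this
space. Hence `f_I(z) = ∑ z ^ n a_n` for some `a_n ∈ ℍ`, with no need to split `f_I` into complex
components. Conversely, every power series with bounded coefficients on the right is slice regular
(`isSliceRegularOn_of_hasSum`), and a slice function is determined by one slice
(`IsSliceOn.eqOn_unitBall`).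

The monomials `e^{Int} a` of different degrees are orthogonal in `L²(𝕋_I)` for its real inner
product (`orthogonalFamily_monomial`). Parseval's identity on the circles of radius `r < 1` gives
`‖f_I‖² = ∑ |a_n|²` (`hardyNorm_eq`), and `g = ∑ e^{Int} a_n` has the same norm. So everything
reduces to Fatou's theorem `ae_tendsto_radial`: `f_I(r e^{It}) → g(e^{It})` for almost every `t`.
Linearity of `f ↦ g` then follows from the uniqueness of limits.

For Fatou's theorem, the series `G(t) = ∑_{n ≥ 1} e^{Int} (In)⁻¹ a_n` converges absolutely because
`∑ |a_n|² < ∞`, and it is a primitive of `t ↦ g(e^{It}) - a_0`. By Lebesgue's differentiation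
theorem `G'(t) = g(e^{It}) - a_0` almost everywhere. At a point `t` of differentiability,
`f_I(r e^{It}) - a_0 = (1 / 2π) ∫ -P_r'(s) (G(t + s) - G(t)) ds`
`= (1 / 2π) ∫ (-s P_r'(s)) (G(t + s) - G(t)) / s ds`,
where `P_r` is the Poisson kernel. The kernels `-s P_r'(s) / 2π` are nonnegative on `[-π, π]` and
concentrate at `0` as `r → 1`, so the integral tends to `G'(t)` (`tendsto_abel_of_hasDerivAt`).
-/

namespace SliceHardy

noncomputable section

/-! ### The angular derivative of the Poisson kernel -/

/-- The denominator `|e^{is} - r|²` of the Poisson kernel. -/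
def poissonDenom (r s : ℝ) : ℝ := 1 - 2 * r * Real.cos s + r ^ 2

/-- The Poisson kernel `P_r(s)` of the unit disc. -/
def poissonFun (r s : ℝ) : ℝ := (1 - r ^ 2) / poissonDenom r s

/-- The negative angular derivative `-∂_s P_r(s)` of the Poisson kernel. -/
def poissonDeriv (r s : ℝ) : ℝ := 2 * r * (1 - r ^ 2) * Real.sin s / poissonDenom r s ^ 2

lemma poissonDenom_eq (r s : ℝ) :
    poissonDenom r s = (1 - r) ^ 2 + 2 * r * (1 - Real.cos s) := by
  unfold poissonDenom; ring

lemma poissonDenom_pos {r : ℝ} (hr : r ∈ Set.Ioo (0 : ℝ) 1) (s : ℝ) : 0 < poissonDenom r s := by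
  rw [poissonDenom_eq]
  have h1 : 0 < 1 - r := sub_pos.2 hr.2
  have h2 : 0 ≤ 1 - Real.cos s := sub_nonneg.2 (Real.cos_le_one s)
  have := hr.1
  positivity

lemma hasDerivAt_poissonFun {r : ℝ} (hr : r ∈ Set.Ioo (0 : ℝ) 1) (s : ℝ) :
    HasDerivAt (poissonFun r) (-poissonDeriv r s) s := by
  have h : HasDerivAt (poissonDenom r) (2 * r * Real.sin s) s := by
    unfold poissonDenom
    convert! (((Real.hasDerivAt_cos s).const_mul (2 * r)).const_sub 1).add_const (r ^ 2) using 1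
    ring
  convert! (hasDerivAt_const s (1 - r ^ 2)).div h (poissonDenom_pos hr s).ne' using 1
  unfold poissonDeriv
  ring

lemma continuous_poissonDeriv {r : ℝ} (hr : r ∈ Set.Ioo (0 : ℝ) 1) :
    Continuous (poissonDeriv r) := by
  have h : Continuous (poissonDenom r) := by unfold poissonDenom; fun_prop
  exact (by fun_prop : Continuous fun s => 2 * r * (1 - r ^ 2) * Real.sin s).div (h.pow 2)
    fun s => (pow_pos (poissonDenom_pos hr s) 2).ne'

lemma poissonFun_neg (r s : ℝ) : poissonFun r (-s) = poissonFun r s := by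
  simp [poissonFun, poissonDenom]

lemma poissonKernel_exp (r s : ℝ) :
    poissonKernel 0 (r : ℂ) (Complex.exp (s * Complex.I)) = poissonFun r s := by
  have h : ‖Complex.exp (s * Complex.I) - r‖ ^ 2 = poissonDenom r s := by
    rw [← Complex.normSq_eq_norm_sq, Complex.normSq_apply]
    simp only [Complex.sub_re, Complex.exp_ofReal_mul_I_re, Complex.ofReal_re, Complex.sub_im,
      Complex.exp_ofReal_mul_I_im, Complex.ofReal_im, poissonDenom]
    linear_combination Real.cos_sq_add_sin_sq s
  rw [poissonKernel_def, sub_zero, sub_zero, h, Complex.norm_exp_ofReal_mul_I, poissonFun]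
  simp

/-- The nonnegative Fourier coefficients of the Poisson kernel: the Poisson integral formula
for `z ↦ z ^ n`. -/
lemma integral_poissonFun_mul_exp {r : ℝ} (hr : r ∈ Set.Ioo (0 : ℝ) 1) (n : ℕ) :
    ∫ s in -Real.pi..Real.pi, (poissonFun r s : ℂ) * Complex.exp (n * s * Complex.I) =
      2 * Real.pi * r ^ n := by
  have hd : DiffContOnCl ℂ (fun z : ℂ => z ^ n) (Metric.ball 0 1) :=
    (differentiable_id.pow n).diffContOnCl
  have hw : (r : ℂ) ∈ Metric.ball (0 : ℂ) 1 := by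
    simp [abs_of_pos hr.1, hr.2]
  have h := hd.circleAverage_poissonKernel_smul hw
  have hper : Function.Periodic
      (fun s : ℝ => (poissonFun r s : ℂ) * Complex.exp (n * s * Complex.I)) (2 * Real.pi) := by
    intro s
    have : Complex.exp (n * ((s + 2 * Real.pi : ℝ) : ℂ) * Complex.I) =
        Complex.exp (n * s * Complex.I) :=
      Complex.exp_eq_exp_iff_exists_int.2 ⟨n, by push_cast; ring⟩
    simp only [this, poissonFun, poissonDenom, Real.cos_add_two_pi]
  have h2 := hper.intervalIntegral_add_eq (-Real.pi) 0
  rw [show -Real.pi + 2 * Real.pi = Real.pi by ring, zero_add] at h2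
  rw [h2]
  rw [Real.circleAverage_def] at h
  have e : ∀ s : ℝ, (poissonKernel 0 (r : ℂ) • fun z : ℂ => z ^ n) (circleMap 0 1 s) =
      (poissonFun r s : ℂ) * Complex.exp (n * s * Complex.I) := by
    intro s
    have : circleMap 0 1 s = Complex.exp (s * Complex.I) := by simp [circleMap]
    rw [this, Pi.smul_apply', poissonKernel_exp, ← Complex.exp_nat_mul, Complex.real_smul]
    ring_nf
  simp only [e] at h
  have hpi : (Real.pi : ℂ) ≠ 0 := by exact_mod_cast Real.pi_ne_zero
  rw [← h, Complex.real_smul]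
  push_cast
  rw [mul_inv_cancel_left₀ (by simp [hpi])]

/-- Integration by parts; the boundary terms cancel by periodicity. -/
lemma integral_poissonDeriv_mul_exp {r : ℝ} (hr : r ∈ Set.Ioo (0 : ℝ) 1) (n : ℕ) :
    ∫ s in -Real.pi..Real.pi, (poissonDeriv r s : ℂ) * Complex.exp (n * s * Complex.I) =
      2 * Real.pi * (Complex.I * n * r ^ n) := by
  have hP : ∀ s : ℝ, HasDerivAt (fun s : ℝ => (poissonFun r s : ℂ)) (-(poissonDeriv r s : ℂ)) s :=
    fun s => by simpa using! (hasDerivAt_poissonFun hr s).ofReal_comp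
  have hE : ∀ s : ℝ, HasDerivAt (fun s : ℝ => Complex.exp (n * s * Complex.I))
      (Complex.exp (n * s * Complex.I) * (n * Complex.I)) s := by
    intro s
    have h1 : HasDerivAt (fun s : ℝ => (n * s * Complex.I : ℂ)) (n * Complex.I) s := by
      simpa using ((Complex.ofRealCLM.hasDerivAt (x := s)).const_mul (n : ℂ)).mul_const Complex.I
    exact h1.cexp
  have hc := continuous_poissonDeriv hr
  have h := intervalIntegral.integral_mul_deriv_eq_deriv_mul (a := -Real.pi) (b := Real.pi)
    (fun s _ => hP s) (fun s _ => hE s)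
    (Continuous.intervalIntegrable (by fun_prop) _ _)
    (Continuous.intervalIntegrable (by fun_prop) _ _)
  have e1 : Complex.exp (n * ((-Real.pi : ℝ) : ℂ) * Complex.I) =
      Complex.exp (n * (Real.pi : ℝ) * Complex.I) :=
    Complex.exp_eq_exp_iff_exists_int.2 ⟨-n, by push_cast; ring⟩
  rw [e1, poissonFun_neg, sub_self, zero_sub] at h
  simp only [neg_mul, intervalIntegral.integral_neg, neg_neg] at h
  rw [← h]
  simp only [← mul_assoc, intervalIntegral.integral_mul_const]
  rw [integral_poissonFun_mul_exp hr]
  ring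

/-- Up to a boundary term that vanishes as `r → 1`, the kernel `-s P_r'(s)` has the mass of the
Poisson kernel. -/
lemma integral_mul_poissonDeriv {r : ℝ} (hr : r ∈ Set.Ioo (0 : ℝ) 1) :
    ∫ s in -Real.pi..Real.pi, s * poissonDeriv r s =
      2 * Real.pi * (1 - (1 - r) / (1 + r)) := by
  have hc := continuous_poissonDeriv hr
  have h := intervalIntegral.integral_mul_deriv_eq_deriv_mul (a := -Real.pi) (b := Real.pi)
    (u := fun s => s) (u' := fun _ => 1)
    (fun s _ => hasDerivAt_id s) (fun s _ => hasDerivAt_poissonFun hr s)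
    (Continuous.intervalIntegrable (by fun_prop) _ _)
    (Continuous.intervalIntegrable (by fun_prop) _ _)
  have h0 : ∫ s in -Real.pi..Real.pi, poissonFun r s = 2 * Real.pi := by
    have := integral_poissonFun_mul_exp hr 0
    simp only [CharP.cast_eq_zero, zero_mul, Complex.exp_zero, mul_one, pow_zero] at this
    rw [intervalIntegral.integral_ofReal] at this
    exact_mod_cast this
  have h1 : poissonFun r Real.pi = (1 - r) / (1 + r) := by
    have := hr.1
    rw [poissonFun, poissonDenom, Real.cos_pi]
    have h2 : 1 - 2 * r * -1 + r ^ 2 = (1 + r) ^ 2 := by ring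
    rw [h2, div_eq_div_iff (by positivity) (by positivity)]
    ring
  simp only [mul_neg, intervalIntegral.integral_neg, one_mul, poissonFun_neg, h0, h1] at h
  linear_combination -h

lemma mul_poissonDeriv_nonneg {r : ℝ} (hr : r ∈ Set.Ioo (0 : ℝ) 1) {s : ℝ}
    (hs : s ∈ Set.Ioc (-Real.pi) Real.pi) : 0 ≤ s * poissonDeriv r s := by
  have h1 : 0 ≤ 1 - r ^ 2 := by nlinarith [hr.1, hr.2]
  have h2 : 0 ≤ s * Real.sin s := by
    rcases le_total 0 s with h | h
    · exact mul_nonneg h (Real.sin_nonneg_of_nonneg_of_le_pi h hs.2)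
    · exact mul_nonneg_of_nonpos_of_nonpos h (Real.sin_nonpos_of_nonpos_of_neg_pi_le h hs.1.le)
  have h3 := hr.1.le
  have : s * poissonDeriv r s = 2 * r * (1 - r ^ 2) * (s * Real.sin s) / poissonDenom r s ^ 2 := by
    unfold poissonDeriv; ring
  rw [this]
  positivity

/-- Away from the peak `s = 0` the kernel `-s P_r'(s)` is `O(1 - r²)`. -/
lemma mul_poissonDeriv_le {r δ s : ℝ} (hr : r ∈ Set.Ioo (1 / 2 : ℝ) 1) (hδ : 0 < δ)
    (hs : s ∈ Set.Ioc (-Real.pi) Real.pi) (hδs : δ ≤ |s|) :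
    |s * poissonDeriv r s| ≤ 2 * Real.pi * (1 - r ^ 2) / (1 - Real.cos δ) ^ 2 := by
  have hsπ : |s| ≤ Real.pi := abs_le.2 ⟨hs.1.le, hs.2⟩
  have hcos : Real.cos s ≤ Real.cos δ := by
    rw [← Real.cos_abs s]
    exact Real.cos_le_cos_of_nonneg_of_le_pi hδ.le hsπ hδs
  have hδ1 : 0 < 1 - Real.cos δ := by
    have : Real.cos δ < Real.cos 0 :=
      Real.cos_lt_cos_of_nonneg_of_le_pi le_rfl (hδs.trans hsπ) hδ
    rw [Real.cos_zero] at this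
    linarith
  have hden : 1 - Real.cos δ ≤ poissonDenom r s := by
    rw [poissonDenom_eq]
    nlinarith [hr.1, sq_nonneg (1 - r)]
  have h1 : 0 ≤ 1 - r ^ 2 := by nlinarith [hr.1, hr.2]
  have hr0 : 0 < r := by linarith [hr.1]
  have e : |s * poissonDeriv r s| =
      |s| * (2 * r * (1 - r ^ 2) * |Real.sin s|) / poissonDenom r s ^ 2 := by
    rw [poissonDeriv, ← mul_div_assoc, abs_div, abs_mul, abs_mul, abs_mul, abs_mul,
      abs_of_nonneg h1, abs_of_pos hr0, abs_of_nonneg (sq_nonneg (poissonDenom r s)), abs_two]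
  rw [e]
  have hn : |s| * (2 * r * (1 - r ^ 2) * |Real.sin s|) ≤ 2 * Real.pi * (1 - r ^ 2) := by
    have hsin := Real.abs_sin_le_one s
    calc |s| * (2 * r * (1 - r ^ 2) * |Real.sin s|)
        ≤ Real.pi * (2 * 1 * (1 - r ^ 2) * 1) := by gcongr; exact hr.2.le
      _ = _ := by ring
  have := Real.pi_pos
  gcongr

/-- The kernels `-s P_r'(s) / 2π` concentrate at `s = 0` as `r → 1`. -/
lemma tendsto_integral_mul_poissonDeriv_smul {E : Type*} [NormedAddCommGroup E] [NormedSpace ℝ E]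
    [CompleteSpace E] {g : ℝ → E} (hg : IntegrableOn g (Set.Ioc (-Real.pi) Real.pi))
    (hc : ContinuousAt g 0) :
    Tendsto (fun r : ℝ => ∫ s in -Real.pi..Real.pi,
      ((2 * Real.pi)⁻¹ * (s * poissonDeriv r s)) • g s) (𝓝[<] 1) (𝓝 (g 0)) := by
  have hπ := Real.pi_pos
  have hle : -Real.pi ≤ Real.pi := by linarith
  have hev : ∀ᶠ r : ℝ in 𝓝[<] 1, r ∈ Set.Ioo (1 / 2 : ℝ) 1 := Ioo_mem_nhdsLT (by norm_num)
  have hsub : ∀ {r : ℝ}, r ∈ Set.Ioo (1 / 2 : ℝ) 1 → r ∈ Set.Ioo (0 : ℝ) 1 :=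
    fun h => ⟨by linarith [h.1], h.2⟩
  simp only [intervalIntegral.integral_of_le hle]
  refine tendsto_setIntegral_peak_smul_of_integrableOn_of_tendsto (x₀ := (0 : ℝ))
    measurableSet_Ioc measurableSet_Ioc subset_rfl self_mem_nhdsWithin (by simp) ?_ ?_ ?_ ?_ hg
    (hc.tendsto.mono_left nhdsWithin_le_nhds)
  · filter_upwards [hev] with r hr s hs
    exact mul_nonneg (by positivity) (mul_poissonDeriv_nonneg (hsub hr) hs)
  · intro u hu h0
    obtain ⟨δ, hδ, hδu⟩ := Metric.isOpen_iff.1 hu 0 h0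
    rw [Metric.tendstoUniformlyOn_iff]
    intro ε hε
    have hlim : Tendsto (fun r : ℝ => (2 * Real.pi)⁻¹ *
        (2 * Real.pi * (1 - r ^ 2) / (1 - Real.cos δ) ^ 2)) (𝓝[<] 1) (𝓝 0) := by
      have : Continuous fun r : ℝ => (2 * Real.pi)⁻¹ *
        (2 * Real.pi * (1 - r ^ 2) / (1 - Real.cos δ) ^ 2) := by fun_prop
      simpa using (this.tendsto 1).mono_left nhdsWithin_le_nhds
    filter_upwards [hev, hlim.eventually (gt_mem_nhds hε)] with r hr hrε s hs
    have hδs : δ ≤ |s| := by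
      by_contra! h
      exact hs.2 (hδu (by simpa using h))
    rw [Pi.zero_apply, dist_zero_left, Real.norm_eq_abs, abs_mul,
      abs_of_pos (by positivity : 0 < (2 * Real.pi)⁻¹)]
    refine lt_of_le_of_lt ?_ hrε
    gcongr
    exact mul_poissonDeriv_le hr hδ hs.1 hδs
  · have hlim : Tendsto (fun r : ℝ => 1 - (1 - r) / (1 + r)) (𝓝[<] 1) (𝓝 1) := by
      have : ContinuousAt (fun r : ℝ => 1 - (1 - r) / (1 + r)) 1 := by
        refine continuousAt_const.sub (ContinuousAt.div (by fun_prop) (by fun_prop) (by norm_num))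
      simpa [ContinuousAt] using this.tendsto.mono_left nhdsWithin_le_nhds
    refine hlim.congr' ?_
    filter_upwards [hev] with r hr
    rw [integral_const_mul, ← intervalIntegral.integral_of_le hle,
      integral_mul_poissonDeriv (hsub hr)]
    field_simp
  · filter_upwards [hev] with r hr
    have := continuous_poissonDeriv (hsub hr)
    exact Continuous.aestronglyMeasurable (by fun_prop)

/-! ### Abel summation of a differentiated Fourier series -/

lemma norm_exp_nat_mul_I (n : ℕ) (t : ℝ) : ‖Complex.exp (n * t * Complex.I)‖ = 1 := by
  simpa using Complex.norm_exp_ofReal_mul_I (n * t)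

lemma continuous_tsum_exp_smul {E : Type*} [NormedAddCommGroup E] [NormedSpace ℂ E]
    [CompleteSpace E] {b : ℕ → E} (hb : Summable fun n => ‖b n‖) :
    Continuous fun t : ℝ => ∑' n : ℕ, Complex.exp (n * t * Complex.I) • b n :=
  continuous_tsum (fun n => by fun_prop) hb fun n t => by
    rw [norm_smul, norm_exp_nat_mul_I, one_mul]

section Fatou

variable {E : Type*} [NormedAddCommGroup E] [NormedSpace ℂ E] [NormedSpace ℝ E]
  [IsScalarTower ℝ ℂ E] [CompleteSpace E]

/-- Integrating against `-P_r'` differentiates the Poisson extension of an absolutely convergent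
Fourier series. -/
lemma integral_poissonDeriv_smul_tsum {b : ℕ → E} (hb : Summable fun n => ‖b n‖) {r : ℝ}
    (hr : r ∈ Set.Ioo (0 : ℝ) 1) (t₀ : ℝ) :
    ∫ s in -Real.pi..Real.pi, poissonDeriv r s •
        ∑' n : ℕ, Complex.exp (n * (t₀ + s : ℝ) * Complex.I) • b n =
      (2 * Real.pi) • ∑' n : ℕ,
        (Complex.I * n * r ^ n * Complex.exp (n * t₀ * Complex.I)) • b n := by
  have hc := continuous_poissonDeriv hr
  have key : ∀ n : ℕ, ∫ s in -Real.pi..Real.pi, poissonDeriv r s •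
      Complex.exp (n * (t₀ + s : ℝ) * Complex.I) • b n =
      (2 * Real.pi) • (Complex.I * n * r ^ n * Complex.exp (n * t₀ * Complex.I)) • b n := by
    intro n
    have e : ∀ s : ℝ, poissonDeriv r s • Complex.exp (n * (t₀ + s : ℝ) * Complex.I) • b n =
        ((poissonDeriv r s : ℂ) * Complex.exp (n * s * Complex.I)) •
          (Complex.exp (n * t₀ * Complex.I) • b n) := by
      intro s
      rw [smul_smul, ← smul_assoc, Complex.real_smul]
      congr 1
      rw [mul_assoc (poissonDeriv r s : ℂ), ← Complex.exp_add]
      push_cast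
      ring_nf
    simp only [e]
    have hL := ((ContinuousLinearMap.toSpanSingleton ℂ
      (Complex.exp (n * t₀ * Complex.I) • b n)).restrictScalars ℝ).intervalIntegral_comp_comm
      (Continuous.intervalIntegrable (μ := volume) (by fun_prop : Continuous fun s : ℝ =>
        (poissonDeriv r s : ℂ) * Complex.exp (n * s * Complex.I)) (-Real.pi) Real.pi)
    simp only [ContinuousLinearMap.coe_restrictScalars', ContinuousLinearMap.toSpanSingleton_apply]
      at hL
    rw [hL, integral_poissonDeriv_mul_exp hr, smul_smul, ← smul_assoc, Complex.real_smul]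
    push_cast
    ring_nf
  have hsum : ∀ s : ℝ, Summable fun n : ℕ => Complex.exp (n * (t₀ + s : ℝ) * Complex.I) • b n :=
    fun s => Summable.of_norm (by simpa only [norm_smul, norm_exp_nat_mul_I, one_mul] using hb)
  have h := intervalIntegral.hasSum_integral_of_dominated_convergence (μ := volume)
    (a := -Real.pi) (b := Real.pi)
    (F := fun (n : ℕ) (s : ℝ) => poissonDeriv r s •
      Complex.exp (n * (t₀ + s : ℝ) * Complex.I) • b n)
    (f := fun s => poissonDeriv r s • ∑' n : ℕ, Complex.exp (n * (t₀ + s : ℝ) * Complex.I) • b n)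
    (fun n s => |poissonDeriv r s| * ‖b n‖)
    (fun n => Continuous.aestronglyMeasurable (by fun_prop))
    (fun n => Eventually.of_forall fun s _ => by
      rw [norm_smul, norm_smul, norm_exp_nat_mul_I, one_mul, Real.norm_eq_abs])
    (Eventually.of_forall fun s _ => hb.mul_left _)
    (by
      simp only [tsum_mul_left]
      exact Continuous.intervalIntegrable (by fun_prop) _ _)
    (Eventually.of_forall fun s _ => (hsum s).hasSum.const_smul _)
  simp only [key] at h
  rw [← h.tsum_eq, tsum_const_smul'']

/-- If an absolutely convergent Fourier series `∑ e^{int} b_n` is differentiable at `t₀`, then its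
formally differentiated series is Abel summable at `t₀` to the derivative. -/
theorem tendsto_abel_of_hasDerivAt {b : ℕ → E} (hb : Summable fun n => ‖b n‖) {t₀ : ℝ} {D : E}
    (hD : HasDerivAt (fun t : ℝ => ∑' n : ℕ, Complex.exp (n * t * Complex.I) • b n) D t₀) :
    Tendsto (fun r : ℝ => ∑' n : ℕ,
      (Complex.I * n * r ^ n * Complex.exp (n * t₀ * Complex.I)) • b n) (𝓝[<] 1) (𝓝 D) := by
  set G : ℝ → E := fun t => ∑' n : ℕ, Complex.exp (n * t * Complex.I) • b n with hG
  have hGc : Continuous G := continuous_tsum_exp_smul hb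
  -- The difference quotient, extended by `D` at `s = 0`, is the function fed to the peak kernels.
  have hcont : Continuous fun s => dslope G t₀ (t₀ + s) := by
    have h : Continuous (dslope G t₀) :=
      continuousOn_univ.1 ((continuousOn_dslope univ_mem).2
        ⟨hGc.continuousOn, hD.differentiableAt⟩)
    exact h.comp (continuous_const.add continuous_id)
  have hlim := tendsto_integral_mul_poissonDeriv_smul (g := fun s => dslope G t₀ (t₀ + s))
    ((hcont.integrableOn_Icc).mono_set Set.Ioc_subset_Icc_self) hcont.continuousAt
  rw [add_zero, dslope_same, hD.deriv] at hlim
  refine hlim.congr' ?_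
  filter_upwards [Ioo_mem_nhdsLT (zero_lt_one (α := ℝ))] with r hr
  have hc := continuous_poissonDeriv hr
  have e : ∀ s : ℝ, ((2 * Real.pi)⁻¹ * (s * poissonDeriv r s)) • dslope G t₀ (t₀ + s) =
      (2 * Real.pi)⁻¹ • (poissonDeriv r s • G (t₀ + s) - poissonDeriv r s • G t₀) := by
    intro s
    have := sub_smul_dslope G t₀ (t₀ + s)
    rw [add_sub_cancel_left] at this
    rw [← smul_sub, ← this, smul_smul, smul_smul]
    ring_nf
  -- Since `P_r'` has mean zero, the constant `G t₀` may be subtracted from `G`.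
  have h0 : ∫ s in -Real.pi..Real.pi, poissonDeriv r s = 0 := by
    have := integral_poissonDeriv_mul_exp hr 0
    simp only [CharP.cast_eq_zero, zero_mul, Complex.exp_zero, mul_one, mul_zero] at this
    rw [intervalIntegral.integral_ofReal] at this
    exact_mod_cast this
  simp only [e]
  rw [intervalIntegral.integral_smul, intervalIntegral.integral_sub
    (Continuous.intervalIntegrable (by fun_prop) _ _)
    (Continuous.intervalIntegrable (by fun_prop) _ _), intervalIntegral.integral_smul_const, h0,
    zero_smul, sub_zero, integral_poissonDeriv_smul_tsum hb hr, smul_smul,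
    inv_mul_cancel₀ (by positivity), one_smul]

end Fatou

/-! ### The complex structure of a slice -/

lemma mul_self_of_mem_imagUnits {I : ℍ[ℝ]} (hI : I ∈ imagUnits) : I * I = -1 := by
  rw [← pow_two]; exact hI

/-- The algebra homomorphism `x + y i ↦ x + y I` from `ℂ` onto `ℂ_I`. -/
def sliceHom (I : imagUnits) : ℂ →ₐ[ℝ] ℍ[ℝ] :=
  Complex.liftAux (I : ℍ[ℝ]) (mul_self_of_mem_imagUnits I.2)

lemma sliceHom_apply (I : imagUnits) (z : ℂ) : sliceHom I z = slicePt I z.re z.im := by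
  rw [sliceHom, Complex.liftAux_apply, slicePt, Quaternion.coe_mul_eq_smul]
  rfl

lemma norm_sliceHom (I : imagUnits) (z : ℂ) : ‖sliceHom I z‖ = ‖z‖ := by
  have h := norm_slicePt I.2 z.re z.im
  rw [← sliceHom_apply] at h
  have h2 : ‖z‖ ^ 2 = z.re ^ 2 + z.im ^ 2 := by
    rw [← Complex.normSq_eq_norm_sq, Complex.normSq_apply]; ring
  exact (sq_eq_sq₀ (norm_nonneg _) (norm_nonneg _)).1 (h.trans h2.symm)

lemma sliceHom_exp (I : imagUnits) (t : ℝ) :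
    sliceHom I (Complex.exp (t * Complex.I)) = expUnit I t := by
  rw [sliceHom_apply, Complex.exp_ofReal_mul_I_re, Complex.exp_ofReal_mul_I_im, expUnit]

lemma expUnit_pow (I : imagUnits) (t : ℝ) (n : ℕ) : expUnit I t ^ n = expUnit I (n * t) := by
  rw [← sliceHom_exp, ← map_pow, ← Complex.exp_nat_mul, ← sliceHom_exp]
  push_cast
  ring_nf

/-- The structure of a complex normed space on `ℍ` in which `x + y i` acts as left
multiplication by `x + y I`. -/
abbrev sliceNormedSpace (I : imagUnits) : NormedSpace ℂ ℍ[ℝ] where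
  toModule := Module.compHom ℍ[ℝ] (sliceHom I).toRingHom
  norm_smul_le z q := by
    change ‖sliceHom I z * q‖ ≤ ‖z‖ * ‖q‖
    rw [norm_mul, norm_sliceHom]

lemma isScalarTower_slice (I : imagUnits) :
    letI := sliceNormedSpace I
    IsScalarTower ℝ ℂ ℍ[ℝ] := by
  let := sliceNormedSpace I
  refine ⟨fun x z q => ?_⟩
  change sliceHom I (x • z) * q = x • (sliceHom I z * q)
  rw [map_smul, smul_mul_assoc]

/-! ### Arc length on `𝕋_I` -/

/-- The parametrization `t ↦ e^{It}` identifies null sets of `𝕋_I` with those of `(0, 2π]`. -/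
lemma ae_arcMeasure_iff (I : imagUnits) {p : sliceCircle (I : ℍ[ℝ]) → Prop} :
    (∀ᵐ ζ ∂arcMeasure I, p ζ) ↔
      ∀ᵐ t ∂volume.restrict (Set.Ioc 0 (2 * Real.pi)), p (circleParam I t) := by
  set S : Set ℝ := Set.Ioc 0 (2 * Real.pi)
  have hS : MeasurableSet S := measurableSet_Ioc
  have hinj : Function.Injective fun t : S => circleParam I t := by
    intro s t h
    have h1 : sliceHom I (Complex.exp ((s : ℝ) * Complex.I)) =
        sliceHom I (Complex.exp ((t : ℝ) * Complex.I)) := by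
      rw [sliceHom_exp, sliceHom_exp]
      exact congrArg Subtype.val h
    have h2 : Complex.exp ((s : ℝ) * Complex.I) = Complex.exp ((t : ℝ) * Complex.I) := by
      rw [← sub_eq_zero, ← norm_eq_zero, ← norm_sliceHom I, map_sub, h1, sub_self, norm_zero]
    obtain ⟨n, hn⟩ := Complex.exp_eq_exp_iff_exists_int.1 h2
    have h3 : (s : ℝ) = t + n * (2 * Real.pi) := by
      have h4 : ((s : ℝ) : ℂ) = ((t + n * (2 * Real.pi) : ℝ) : ℂ) := by
        push_cast
        refine mul_right_cancel₀ Complex.I_ne_zero (hn.trans (by ring))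
      exact_mod_cast h4
    have hn0 : n = 0 := by
      have hp := Real.two_pi_pos
      obtain ⟨s1, s2⟩ := s.2
      obtain ⟨t1, t2⟩ := t.2
      have a : (n : ℝ) < 1 := by nlinarith
      have b : (-1 : ℝ) < n := by nlinarith
      have a' : n < 1 := by exact_mod_cast a
      have b' : -1 < n := by exact_mod_cast b
      omega
    exact Subtype.ext (by simpa [hn0] using h3)
  have : StandardBorelSpace S := hS.standardBorel
  -- A measurable injection between standard Borel spaces is a measurable embedding, so null sets
  -- are transported without any measurability assumption on `p`.
  have hemb : MeasurableEmbedding fun t : S => circleParam I t :=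
    ((continuous_circleParam I).measurable.comp measurable_subtype_coe).measurableEmbedding hinj
  have hmap : (volume.restrict S).map (circleParam I) =
      (volume.comap (Subtype.val : S → ℝ)).map fun t : S => circleParam I t := by
    rw [← map_comap_subtype_coe hS, Measure.map_map (continuous_circleParam I).measurable
      measurable_subtype_coe]
    rfl
  have hc : ENNReal.ofReal (1 / (2 * Real.pi)) ≠ 0 := by
    simpa using Real.pi_pos
  rw [arcMeasure, Measure.ae_ennreal_smul_measure_iff hc, hmap, hemb.ae_map_iff,
    ← map_comap_subtype_coe hS, (MeasurableEmbedding.subtype_coe hS).ae_map_iff]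

lemma lintegral_arcMeasure (I : imagUnits) {F : sliceCircle (I : ℍ[ℝ]) → ℝ≥0∞}
    (hF : AEMeasurable F (arcMeasure I)) :
    ∫⁻ ζ, F ζ ∂arcMeasure I = ENNReal.ofReal (1 / (2 * Real.pi)) *
      ∫⁻ t in Set.Ioc 0 (2 * Real.pi), F (circleParam I t) := by
  have hc : ENNReal.ofReal (1 / (2 * Real.pi)) ≠ 0 := by
    simpa using Real.pi_pos
  rw [arcMeasure, lintegral_smul_measure, lintegral_map' _
    (continuous_circleParam I).aemeasurable, smul_eq_mul]
  exact (aemeasurable_smul_measure_iff hc).1 hF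

lemma integral_arcMeasure (I : imagUnits) {F : sliceCircle (I : ℍ[ℝ]) → ℝ} (hF : Continuous F) :
    ∫ ζ, F ζ ∂arcMeasure I = (1 / (2 * Real.pi)) *
      ∫ t in 0..2 * Real.pi, F (circleParam I t) := by
  rw [arcMeasure, integral_smul_measure, integral_map (continuous_circleParam I).aemeasurable
    hF.aestronglyMeasurable, intervalIntegral.integral_of_le Real.two_pi_pos.le,
    ENNReal.toReal_ofReal (by positivity), smul_eq_mul]

/-! ### Orthogonality of the monomials -/

lemma norm_sliceCircle {I : ℍ[ℝ]} (ζ : sliceCircle I) : ‖(ζ : ℍ[ℝ])‖ = 1 := by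
  simpa using ζ.2.1

lemma norm_monomial (I : imagUnits) (k : ℕ) (a : ℍ[ℝ]) : ‖monomial I k a‖ = ‖a‖ := by
  have h : ∀ ζ : sliceCircle (I : ℍ[ℝ]), ‖(ζ : ℍ[ℝ]) ^ k * a‖ₑ = ‖a‖ₑ := fun ζ => by
    rw [enorm_mul, enorm_pow, ← ofReal_norm, norm_sliceCircle]
    simp
  rw [monomial, Lp.norm_toLp, eLpNorm_congr_enorm_ae (g := fun _ => a)
    (Eventually.of_forall h), eLpNorm_const _ (by simp) (IsProbabilityMeasure.ne_zero _)]
  simp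

/-- Left multiplication by a unit quaternion preserves the inner product. -/
lemma inner_mul_left_of_norm_eq_one {u : ℍ[ℝ]} (hu : ‖u‖ = 1) (p q : ℍ[ℝ]) :
    inner ℝ (u * p) (u * q) = inner ℝ p q := by
  rw [real_inner_eq_norm_add_mul_self_sub_norm_mul_self_sub_norm_mul_self_div_two,
    real_inner_eq_norm_add_mul_self_sub_norm_mul_self_sub_norm_mul_self_div_two, ← mul_add,
    norm_mul, norm_mul, norm_mul, hu]
  simp

lemma integral_inner_expUnit_mul {I : imagUnits} {m : ℕ} (hm : m ≠ 0) (a b : ℍ[ℝ]) :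
    ∫ t in 0..2 * Real.pi, inner ℝ (expUnit I (m * t) * a) b = 0 := by
  have e : ∀ t : ℝ, inner ℝ (expUnit I (m * t) * a) b =
      Real.cos (m * t) * inner ℝ a b + Real.sin (m * t) * inner ℝ ((I : ℍ[ℝ]) * a) b := by
    intro t
    rw [expUnit, slicePt, add_mul, mul_assoc, Quaternion.coe_mul_eq_smul,
      Quaternion.coe_mul_eq_smul, inner_add_left, real_inner_smul_left, real_inner_smul_left]
  have hm' : (m : ℝ) ≠ 0 := by exact_mod_cast hm
  have h2 : Real.sin (m * (2 * Real.pi)) = 0 := by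
    have := Real.sin_nat_mul_pi (m * 2)
    push_cast at this
    rwa [mul_assoc] at this
  have h3 : Real.cos (m * (2 * Real.pi)) = 1 := Real.cos_nat_mul_two_pi m
  simp only [e]
  rw [intervalIntegral.integral_add (Continuous.intervalIntegrable (by fun_prop) _ _)
    (Continuous.intervalIntegrable (by fun_prop) _ _), intervalIntegral.integral_mul_const,
    intervalIntegral.integral_mul_const,
    intervalIntegral.integral_comp_mul_left (fun x => Real.cos x) hm',
    intervalIntegral.integral_comp_mul_left (fun x => Real.sin x) hm']
  simp [h2, h3]

lemma inner_monomial_of_lt (I : imagUnits) {k l : ℕ} (hkl : k < l) (a b : ℍ[ℝ]) :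
    inner ℝ (monomial I l a) (monomial I k b) = 0 := by
  rw [L2.inner_def]
  have h : ∫ ζ, inner ℝ ((monomial I l a : sliceCircle (I : ℍ[ℝ]) → ℍ[ℝ]) ζ)
      ((monomial I k b : sliceCircle (I : ℍ[ℝ]) → ℍ[ℝ]) ζ) ∂arcMeasure I =
      ∫ ζ : sliceCircle (I : ℍ[ℝ]), inner ℝ ((ζ : ℍ[ℝ]) ^ (l - k) * a) b ∂arcMeasure I := by
    refine integral_congr_ae ?_
    filter_upwards [(memLp_monomial I l a).coeFn_toLp, (memLp_monomial I k b).coeFn_toLp]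
      with ζ h1 h2
    rw [monomial, monomial, h1, h2]
    obtain ⟨m, rfl⟩ := Nat.exists_eq_add_of_lt hkl
    rw [show k + m + 1 - k = m + 1 by omega, add_assoc, pow_add, mul_assoc]
    exact inner_mul_left_of_norm_eq_one (by simp [norm_sliceCircle]) _ _
  rw [h, integral_arcMeasure I (by fun_prop)]
  have e : ∀ t, ((circleParam I t : sliceCircle (I : ℍ[ℝ])) : ℍ[ℝ]) ^ (l - k) =
      expUnit I ((l - k : ℕ) * t) := fun t => expUnit_pow I t _
  simp only [e]
  rw [integral_inner_expUnit_mul (by omega), mul_zero]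

/-- `a ↦ e^{Ikt} a` as a real linear isometry into `L²(𝕋_I)`. -/
def monomialₗᵢ (I : imagUnits) (k : ℕ) : ℍ[ℝ] →ₗᵢ[ℝ] L2Circle I where
  toFun := monomial I k
  map_add' := monomial_add I k
  map_smul' c a := by
    rw [RingHom.id_apply, monomial, monomial, ← MemLp.toLp_const_smul]
    congr 1
    funext ζ
    simp
  norm_map' := norm_monomial I k

/-- The monomials `e^{Ikt} a` of different degrees are orthogonal for the real inner product of
`L²(𝕋_I)`. -/
lemma orthogonalFamily_monomial (I : imagUnits) :
    OrthogonalFamily ℝ (fun _ : ℕ => ℍ[ℝ]) (monomialₗᵢ I) := by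
  intro k l hkl a b
  rcases lt_or_gt_of_ne hkl with h | h
  · rw [real_inner_comm]
    exact inner_monomial_of_lt I h b a
  · exact inner_monomial_of_lt I h a b

lemma summable_monomial (I : imagUnits) {a : ℕ → ℍ[ℝ]} (ha : Summable fun k => ‖a k‖ ^ 2) :
    Summable fun k => monomial I k (a k) :=
  ((orthogonalFamily_monomial I).summable_iff_norm_sq_summable a).2 ha

/-- Parseval's identity. -/
lemma hasSum_norm_sq_of_hasSum_monomial (I : imagUnits) {a : ℕ → ℍ[ℝ]} {g : L2Circle I}
    (h : HasSum (fun k => monomial I k (a k)) g) : HasSum (fun k => ‖a k‖ ^ 2) (‖g‖ ^ 2) := by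
  have h1 := (h.norm.pow 2 : Tendsto _ _ _)
  refine h1.congr fun s => ?_
  exact (orthogonalFamily_monomial I).norm_sum a s

/-! ### Slice regular functions and power series -/

lemma one_div_eq_coe_half : (1 / 2 : ℍ[ℝ]) = ((1 / 2 : ℝ) : ℍ[ℝ]) := by
  rw [one_div, one_div, Quaternion.coe_inv]
  rfl

lemma slicePt_mem_unitBall {I : ℍ[ℝ]} (hI : I ∈ imagUnits) {x y : ℝ} :
    slicePt I x y ∈ unitBall ↔ x ^ 2 + y ^ 2 < 1 := by
  rw [mem_ball_zero_iff, ← norm_slicePt hI, sq_lt_one_iff₀ (norm_nonneg _)]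

lemma sliceHom_mem_unitBall (I : imagUnits) {z : ℂ} : sliceHom I z ∈ unitBall ↔ ‖z‖ < 1 := by
  rw [mem_ball_zero_iff, norm_sliceHom]

/-- Every quaternion lies on some slice. -/
lemma exists_eq_slicePt (q : ℍ[ℝ]) (I : imagUnits) :
    ∃ J ∈ imagUnits, ∃ x y : ℝ, q = slicePt J x y := by
  by_cases h : q.im = 0
  · refine ⟨I, I.2, q.re, 0, ?_⟩
    rw [slicePt, Quaternion.coe_zero, zero_mul, add_zero]
    simpa [h] using (Quaternion.re_add_im q).symm
  · have hn : ‖q.im‖ ≠ 0 := norm_ne_zero_iff.2 h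
    refine ⟨‖q.im‖⁻¹ • q.im, ?_, q.re, ‖q.im‖, ?_⟩
    · change (‖q.im‖⁻¹ • q.im) ^ 2 = -1
      have h2 : q.im ^ 2 = -((‖q.im‖ ^ 2 : ℝ) : ℍ[ℝ]) := by
        rw [Quaternion.sq_eq_neg_normSq.2 (by simp), Quaternion.normSq_eq_norm_mul_self, pow_two]
      rw [smul_pow, h2, smul_neg, ← Quaternion.coe_mul_eq_smul, ← Quaternion.coe_mul, ← mul_pow,
        inv_mul_cancel₀ hn]
      simp
    · rw [slicePt, Quaternion.coe_mul_eq_smul, smul_smul, mul_inv_cancel₀ hn, one_smul]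
      exact (Quaternion.re_add_im q).symm

/-- A slice function on the ball is determined by its values on one slice. -/
lemma IsSliceOn.eqOn_unitBall {F G : ℍ[ℝ] → ℍ[ℝ]} (hF : IsSliceOn F unitBall)
    (hG : IsSliceOn G unitBall) (I : imagUnits)
    (h : ∀ z : ℂ, ‖z‖ < 1 → F (sliceHom I z) = G (sliceHom I z)) : Set.EqOn F G unitBall := by
  intro q hq
  obtain ⟨J, hJ, x, y, rfl⟩ := exists_eq_slicePt q I
  have hxy := (slicePt_mem_unitBall hJ).1 hq
  have h1 : slicePt (I : ℍ[ℝ]) x y ∈ unitBall := (slicePt_mem_unitBall I.2).2 hxy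
  have h2 : slicePt (I : ℍ[ℝ]) x (-y) ∈ unitBall :=
    (slicePt_mem_unitBall I.2).2 (by rwa [neg_sq])
  have e : ∀ v : ℝ, slicePt (I : ℍ[ℝ]) x v ∈ unitBall →
      F (slicePt (I : ℍ[ℝ]) x v) = G (slicePt (I : ℍ[ℝ]) x v) := by
    intro v hv
    have hs : slicePt (I : ℍ[ℝ]) x v = sliceHom I ⟨x, v⟩ := (sliceHom_apply I ⟨x, v⟩).symm
    rw [hs] at hv ⊢
    exact h _ ((sliceHom_mem_unitBall I).1 hv)
  rw [hF I I.2 J hJ x y h1 h2 hq, hG I I.2 J hJ x y h1 h2 hq, e _ h1, e _ h2]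

/-- On each slice a slice holomorphic function is a holomorphic function of one complex variable
with values in the complex Banach space `ℍ`. -/
lemma IsSliceHolomorphicOn.differentiableOn {F : ℍ[ℝ] → ℍ[ℝ]} {I : imagUnits}
    (hF : IsSliceHolomorphicOn F unitBall I) :
    letI := sliceNormedSpace I
    DifferentiableOn ℂ (fun z : ℂ => F (sliceHom I z)) (Metric.ball 0 1) := by
  let := sliceNormedSpace I
  have := isScalarTower_slice I
  intro z hz
  have hp : (z.re, z.im) ∈ sliceDom unitBall I := by
    change slicePt I z.re z.im ∈ unitBall
    rw [← sliceHom_apply, sliceHom_mem_unitBall]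
    simpa using hz
  have hd : DifferentiableAt ℝ (sliceRestr F I) (z.re, z.im) :=
    (hF.1.contDiffAt ((isOpen_sliceDom I).mem_nhds hp)).differentiableAt one_ne_zero
  have hcr := hF.2 _ hp
  set D := fderiv ℝ (sliceRestr F I) (z.re, z.im) with hD
  -- Multiplying the Cauchy-Riemann equation by `2 I` shows that `D` is complex linear.
  have hI : (I : ℍ[ℝ]) * D (1, 0) = D (0, 1) := by
    have h2 : D (1, 0) + (I : ℍ[ℝ]) * D (0, 1) = 0 := by
      have h3 : (1 / 2 : ℍ[ℝ]) ≠ 0 := by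
        rw [one_div_eq_coe_half, ← Quaternion.coe_zero]
        exact Quaternion.coe_injective.ne (by norm_num)
      exact (mul_eq_zero.1 hcr).resolve_left h3
    rw [eq_neg_of_add_eq_zero_left h2, mul_neg, ← mul_assoc, mul_self_of_mem_imagUnits I.2]
    simp
  have hreal : HasFDerivAt (fun w : ℂ => F (sliceHom I w))
      (D.comp (Complex.equivRealProdCLM : ℂ →L[ℝ] ℝ × ℝ)) z := by
    have h := HasFDerivAt.comp (x := z) (f := fun w : ℂ => Complex.equivRealProdCLM w)
      (g := sliceRestr F I) (hd.hasFDerivAt) Complex.equivRealProdCLM.hasFDerivAt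
    refine h.congr_of_eventuallyEq (Eventually.of_forall fun w => ?_)
    change F (sliceHom I w) = F (slicePt I w.re w.im)
    rw [sliceHom_apply]
  refine (hasFDerivAt_of_restrictScalars ℝ
    (f' := ContinuousLinearMap.toSpanSingleton ℂ (D (1, 0))) hreal
      ?_).differentiableAt.differentiableWithinAt
  refine ContinuousLinearMap.ext fun w => ?_
  change sliceHom I w * D (1, 0) = D (w.re, w.im)
  have e : ((w.re, w.im) : ℝ × ℝ) = w.re • (1, 0) + w.im • (0, 1) := by simp
  rw [e, map_add, map_smul, map_smul, ← hI, sliceHom_apply, slicePt, add_mul, mul_assoc,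
    Quaternion.coe_mul_eq_smul, Quaternion.coe_mul_eq_smul]

lemma IsSliceHolomorphicOn.exists_hasSum {F : ℍ[ℝ] → ℍ[ℝ]} {I : imagUnits}
    (hF : IsSliceHolomorphicOn F unitBall I) :
    ∃ a : ℕ → ℍ[ℝ], ∀ z : ℂ, ‖z‖ < 1 →
      HasSum (fun n => sliceHom I z ^ n * a n) (F (sliceHom I z)) := by
  let := sliceNormedSpace I
  refine ⟨fun n => ((n.factorial : ℂ)⁻¹) • iteratedDeriv n (fun z : ℂ => F (sliceHom I z)) 0,
    fun z hz => ?_⟩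
  have h := Complex.hasSum_taylorSeries_on_ball (r := 1) hF.differentiableOn (z := z)
    (by simpa using hz)
  refine h.congr_fun fun n => ?_
  rw [sub_zero, smul_comm, ← map_pow]
  rfl

lemma norm_pow_mul_le {a : ℕ → ℍ[ℝ]} {C : ℝ} (ha : ∀ n, ‖a n‖ ≤ C) (q : ℍ[ℝ]) (n : ℕ) :
    ‖q ^ n * a n‖ ≤ ‖q‖ ^ n * C := by
  rw [norm_mul, norm_pow]
  gcongr
  exact ha n

/-- The sum of a quaternionic power series with bounded coefficients on the right is slice
regular on the unit ball. -/
lemma isSliceRegularOn_of_hasSum {a : ℕ → ℍ[ℝ]} {C : ℝ} (ha : ∀ n, ‖a n‖ ≤ C)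
    {F : ℍ[ℝ] → ℍ[ℝ]} (hF : ∀ q ∈ unitBall, HasSum (fun n => q ^ n * a n) (F q)) :
    IsSliceRegularOn F unitBall := by
  refine ⟨fun I hI J hJ x y h1 h2 h3 => ?_, fun J hJ => ?_⟩
  · have s1 := hF _ h1
    have s2 := hF _ h2
    have hs := ((s1.add s2).mul_left (1 / 2)).add ((s2.sub s1).mul_left (J * I / 2))
    refine (hF _ h3).unique (hs.congr_fun fun n => ?_)
    set z : ℂ := ⟨x, y⟩ with hz
    have e1 : slicePt I x y ^ n = slicePt I (z ^ n).re (z ^ n).im := by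
      rw [← sliceHom_apply ⟨I, hI⟩, map_pow, sliceHom_apply]
    have e3 : slicePt J x y ^ n = slicePt J (z ^ n).re (z ^ n).im := by
      rw [← sliceHom_apply ⟨J, hJ⟩, map_pow, sliceHom_apply]
    have e2 : slicePt I x (-y) ^ n = slicePt I (z ^ n).re (-(z ^ n).im) := by
      have hc := sliceHom_apply ⟨I, hI⟩ ((starRingEnd ℂ z) ^ n)
      rw [← map_pow (starRingEnd ℂ), map_pow (starRingEnd ℂ), map_pow, sliceHom_apply,
        ← map_pow (starRingEnd ℂ)] at hc
      exact hc
    rw [e1, e2, e3]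
    have hII : I * I = -1 := mul_self_of_mem_imagUnits hI
    have hdiv : J * I / 2 = ((1 / 2 : ℝ) : ℍ[ℝ]) * (J * I) := by
      rw [div_eq_mul_inv, ← one_div, one_div_eq_coe_half, Quaternion.coe_commutes]
    rw [← add_mul, ← sub_mul, ← mul_assoc, ← mul_assoc, ← add_mul, hdiv, one_div_eq_coe_half]
    congr 1
    simp only [slicePt, Quaternion.coe_mul_eq_smul, smul_mul_assoc, mul_sub, mul_add,
      mul_smul_comm, mul_assoc, hII, mul_neg, mul_one]
    module
  · set J' : imagUnits := ⟨J, hJ⟩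
    let := sliceNormedSpace J'
    have := isScalarTower_slice J'
    have hd : DifferentiableOn ℂ (fun z : ℂ => F (sliceHom J' z)) (Metric.ball 0 1) := by
      intro z hz
      obtain ⟨ρ, hzρ, hρ⟩ := exists_between (mem_ball_zero_iff.1 hz)
      have hρ0 : 0 ≤ ρ := (norm_nonneg z).trans hzρ.le
      have hsum : Summable fun n : ℕ => ρ ^ n * C :=
        (summable_geometric_of_lt_one hρ0 hρ).mul_right C
      have hC : 0 ≤ C := (norm_nonneg _).trans (ha 0)
      have h := Complex.differentiableOn_tsum_of_summable_norm (F := fun n (z : ℂ) => z ^ n • a n)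
        hsum (fun n => ((differentiable_id.pow n).smul_const (a n)).differentiableOn)
        (Metric.isOpen_ball (x := (0 : ℂ)) (ε := ρ)) (fun n w hw => by
          rw [norm_smul, norm_pow]
          have := (mem_ball_zero_iff.1 hw).le
          gcongr
          exact ha n)
      have h2 : DifferentiableAt ℂ (fun w : ℂ => ∑' n : ℕ, w ^ n • a n) z :=
        h.differentiableAt (Metric.isOpen_ball.mem_nhds (mem_ball_zero_iff.2 hzρ))
      refine (h2.congr_of_eventuallyEq ?_).differentiableWithinAt
      filter_upwards [Metric.isOpen_ball.mem_nhds hz] with w hw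
      rw [← (hF _ ((sliceHom_mem_unitBall J').2 (mem_ball_zero_iff.1 hw))).tsum_eq]
      refine tsum_congr fun n => ?_
      rw [← map_pow]
      rfl
    have hmaps : Set.MapsTo (Complex.equivRealProdCLM.symm : ℝ × ℝ → ℂ) (sliceDom unitBall J)
        (Metric.ball 0 1) := by
      intro p hp
      rw [mem_ball_zero_iff, ← sliceHom_mem_unitBall J', sliceHom_apply]
      exact hp
    have hrestr : sliceRestr F J =
        (fun z : ℂ => F (sliceHom J' z)) ∘ (Complex.equivRealProdCLM.symm : ℝ × ℝ → ℂ) := by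
      funext p
      change F (slicePt J p.1 p.2) = F (sliceHom J' _)
      rw [sliceHom_apply]
      rfl
    refine ⟨?_, fun p hp => ?_⟩
    · rw [hrestr]
      exact ((hd.contDiffOn Metric.isOpen_ball).restrict_scalars ℝ).comp
        (Complex.equivRealProdCLM.symm.contDiff.contDiffOn) hmaps
    · have hz := hmaps hp
      have h1 := ((hd.differentiableAt (Metric.isOpen_ball.mem_nhds hz)).hasDerivAt.hasFDerivAt
        ).restrictScalars ℝ
      have h2 := h1.comp p Complex.equivRealProdCLM.symm.hasFDerivAt
      rw [hrestr, h2.fderiv]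
      set d := deriv (fun z : ℂ => F (sliceHom J' z)) (Complex.equivRealProdCLM.symm p)
      have e1 : ∀ v : ℝ × ℝ, (ContinuousLinearMap.comp (ContinuousLinearMap.restrictScalars ℝ
          (ContinuousLinearMap.toSpanSingleton ℂ d))
          (Complex.equivRealProdCLM.symm : ℝ × ℝ →L[ℝ] ℂ)) v = slicePt J v.1 v.2 * d := by
        intro v
        change sliceHom J' _ * d = _
        rw [sliceHom_apply]
        rfl
      have hJJ : J * J = -1 := mul_self_of_mem_imagUnits hJ
      rw [e1, e1]
      simp [slicePt, ← mul_assoc, hJJ]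

/-! ### Convergence of the series of monomials in `L²(𝕋_I)` -/

lemma coeFn_sum_monomial (I : imagUnits) (a : ℕ → ℍ[ℝ]) (s : Finset ℕ) :
    ((∑ k ∈ s, monomial I k (a k) : L2Circle I) : sliceCircle (I : ℍ[ℝ]) → ℍ[ℝ]) =ᵐ[arcMeasure I]
      fun ζ => ∑ k ∈ s, (ζ : ℍ[ℝ]) ^ k * a k := by
  induction s using Finset.cons_induction with
  | empty => simpa using! Lp.coeFn_zero ℍ[ℝ] 2 (arcMeasure I)
  | cons k s hk ih =>
    simp only [Finset.sum_cons]
    filter_upwards [Lp.coeFn_add (monomial I k (a k)) (∑ j ∈ s, monomial I j (a j)), ih,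
      (memLp_monomial I k (a k)).coeFn_toLp] with ζ h1 h2 h3
    rw [h1, Pi.add_apply, h2, monomial, h3]

/-- The `L²` sum and the pointwise sum of a series of monomials agree almost everywhere. -/
lemma ae_eq_of_hasSum_monomial {I : imagUnits} {a : ℕ → ℍ[ℝ]} {g : L2Circle I}
    (hg : HasSum (fun k => monomial I k (a k)) g) {h : sliceCircle (I : ℍ[ℝ]) → ℍ[ℝ]}
    (hh : ∀ ζ : sliceCircle (I : ℍ[ℝ]), HasSum (fun k => (ζ : ℍ[ℝ]) ^ k * a k) (h ζ)) :
    (g : sliceCircle (I : ℍ[ℝ]) → ℍ[ℝ]) =ᵐ[arcMeasure I] h := by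
  obtain ⟨ns, hns, hae⟩ :=
    (tendstoInMeasure_of_tendsto_Lp hg.tendsto_sum_nat).exists_seq_tendsto_ae
  filter_upwards [hae, ae_all_iff.2 fun n => coeFn_sum_monomial I a (Finset.range n)]
    with ζ h1 h2
  simp only [h2] at h1
  exact tendsto_nhds_unique h1 ((hh ζ).tendsto_sum_nat.comp hns.tendsto_atTop)

lemma lintegral_enorm_sq (I : imagUnits) (g : L2Circle I) :
    ∫⁻ ζ, ‖(g : sliceCircle (I : ℍ[ℝ]) → ℍ[ℝ]) ζ‖ₑ ^ 2 ∂arcMeasure I =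
      ENNReal.ofReal (‖g‖ ^ 2) := by
  have h := eLpNorm_nnreal_pow_eq_lintegral (μ := arcMeasure I) (p := 2)
    (f := (g : sliceCircle (I : ℍ[ℝ]) → ℍ[ℝ])) two_ne_zero
  rw [ENNReal.ofReal_pow (norm_nonneg g), Lp.norm_def, ENNReal.ofReal_toReal (Lp.eLpNorm_ne_top g)]
  have e : (((2 : NNReal) : ℝ)) = ((2 : ℕ) : ℝ) := by norm_num
  simp only [e, ENNReal.rpow_natCast] at h
  exact h.symm

/-! ### Power series on a slice and the Hardy norm -/

/-- On the unit disc of the slice `ℂ_I` the function `F` is the sum of the power series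
`∑ q ^ n a_n`, with its coefficients on the right. -/
def HasSliceExpansion (I : imagUnits) (F : ℍ[ℝ] → ℍ[ℝ]) (a : ℕ → ℍ[ℝ]) : Prop :=
  ∀ z : ℂ, ‖z‖ < 1 → HasSum (fun n => sliceHom I z ^ n * a n) (F (sliceHom I z))

lemma exists_sliceHom_eq {I : imagUnits} (ζ : sliceCircle (I : ℍ[ℝ])) :
    ∃ w : ℂ, ‖w‖ = 1 ∧ sliceHom I w = ζ := by
  obtain ⟨x, y, h⟩ := ζ.2.2
  have e : sliceHom I ⟨x, y⟩ = ζ := by rw [sliceHom_apply]; exact h.symm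
  exact ⟨⟨x, y⟩, by rw [← norm_sliceHom I, e, norm_sliceCircle], e⟩

lemma HasSliceExpansion.hasSum_circle {I : imagUnits} {F : ℍ[ℝ] → ℍ[ℝ]} {a : ℕ → ℍ[ℝ]}
    (h : HasSliceExpansion I F a) {r : ℝ} (hr : r ∈ Set.Ico (0 : ℝ) 1)
    (ζ : sliceCircle (I : ℍ[ℝ])) :
    HasSum (fun n => (ζ : ℍ[ℝ]) ^ n * (r ^ n • a n)) (F (r • (ζ : ℍ[ℝ]))) := by
  obtain ⟨w, hw, e⟩ := exists_sliceHom_eq ζ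
  have hz : ‖r • w‖ < 1 := by
    rw [norm_smul, hw, mul_one, Real.norm_of_nonneg hr.1]; exact hr.2
  have h2 := h (r • w) hz
  rw [map_smul, e] at h2
  refine h2.congr_fun fun n => ?_
  rw [smul_pow, smul_mul_assoc, mul_smul_comm]

lemma HasSliceExpansion.summable_norm_smul {I : imagUnits} {F : ℍ[ℝ] → ℍ[ℝ]} {a : ℕ → ℍ[ℝ]}
    (h : HasSliceExpansion I F a) {r : ℝ} (hr : r ∈ Set.Ico (0 : ℝ) 1) :
    Summable fun n => ‖r ^ n • a n‖ := by
  obtain ⟨ρ, hrρ, hρ⟩ := exists_between hr.2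
  have hρ0 : 0 < ρ := hr.1.trans_lt hrρ
  have hs := (h ρ (by simpa [abs_of_pos hρ0] using hρ)).summable.tendsto_atTop_zero.norm
  -- The terms of the series at a radius `ρ > r` are bounded by some `C`.
  obtain ⟨C, hC⟩ := hs.bddAbove_range
  have hgeo : Summable fun n : ℕ => (r / ρ) ^ n * C :=
    (summable_geometric_of_lt_one (by have := hr.1; positivity)
      ((div_lt_one hρ0).2 hrρ)).mul_right C
  refine Summable.of_nonneg_of_le (fun n => norm_nonneg _) (fun n => ?_) hgeo
  have hn : ρ ^ n * ‖a n‖ ≤ C := by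
    have := hC ⟨n, rfl⟩
    simpa [norm_mul, norm_pow, norm_sliceHom, abs_of_pos hρ0] using this
  rw [norm_smul, norm_pow, Real.norm_of_nonneg hr.1, div_pow, div_mul_eq_mul_div,
    le_div_iff₀ (by positivity)]
  have := pow_nonneg hr.1 n
  nlinarith

lemma summable_norm_sq_of_summable_norm {c : ℕ → ℍ[ℝ]} (hc : Summable fun n => ‖c n‖) :
    Summable fun n => ‖c n‖ ^ 2 := by
  obtain ⟨C, hC⟩ := hc.tendsto_atTop_zero.bddAbove_range
  refine Summable.of_nonneg_of_le (fun n => by positivity) (fun n => ?_) (hc.mul_left C)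
  rw [pow_two]
  exact mul_le_mul_of_nonneg_right (hC ⟨n, rfl⟩) (norm_nonneg _)

/-- Parseval's identity on the circle of radius `r < 1`. -/
lemma HasSliceExpansion.lintegral_eq {I : imagUnits} {F : ℍ[ℝ] → ℍ[ℝ]} {a : ℕ → ℍ[ℝ]}
    (h : HasSliceExpansion I F a) {r : ℝ} (hr : r ∈ Set.Ico (0 : ℝ) 1) :
    (Summable fun n => ‖r ^ n • a n‖ ^ 2) ∧
    ENNReal.ofReal (1 / (2 * Real.pi)) *
      ∫⁻ t in Set.Ioc 0 (2 * Real.pi), ‖F (r • expUnit I t)‖ₑ ^ 2 =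
      ENNReal.ofReal (∑' n, ‖r ^ n • a n‖ ^ 2) := by
  have hs := summable_norm_sq_of_summable_norm (h.summable_norm_smul hr)
  obtain ⟨g, hg⟩ := summable_monomial I hs
  have hae := ae_eq_of_hasSum_monomial hg (h.hasSum_circle hr)
  refine ⟨hs, ?_⟩
  rw [(hasSum_norm_sq_of_hasSum_monomial I hg).tsum_eq, ← lintegral_enorm_sq]
  have hm : AEMeasurable (fun ζ : sliceCircle (I : ℍ[ℝ]) => ‖F (r • (ζ : ℍ[ℝ]))‖ₑ ^ 2)
      (arcMeasure I) :=
    (((Lp.aestronglyMeasurable g).congr hae).enorm).pow_const 2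
  refine ((lintegral_congr_ae ?_).trans (lintegral_arcMeasure I hm)).symm
  exact hae.fun_comp fun q => ‖q‖ₑ ^ 2

/-- The partial sums over `‖a n‖ ^ 2` are the limits as `r → 1` of those over `‖r ^ n • a n‖ ^ 2`,
which Parseval's identity bounds by the Hardy norm. -/
lemma sum_norm_sq_le_hardyNormSq {I : imagUnits} {f : unitBall → ℍ[ℝ]} {a : ℕ → ℍ[ℝ]}
    (h : HasSliceExpansion I (ext0 f) a) (hf : hardyNormSq I f < ∞) (s : Finset ℕ) :
    ∑ n ∈ s, ‖a n‖ ^ 2 ≤ (hardyNormSq I f).toReal := by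
  have hlim : Tendsto (fun r : ℝ => ∑ n ∈ s, ‖r ^ n • a n‖ ^ 2) (𝓝[<] 1)
      (𝓝 (∑ n ∈ s, ‖a n‖ ^ 2)) := by
    have hc : Continuous fun r : ℝ => ∑ n ∈ s, ‖r ^ n • a n‖ ^ 2 := by fun_prop
    simpa using (hc.tendsto 1).mono_left nhdsWithin_le_nhds
  refine le_of_tendsto hlim ?_
  filter_upwards [Ico_mem_nhdsLT (zero_lt_one (α := ℝ))] with r hr
  obtain ⟨hs, he⟩ := h.lintegral_eq hr
  refine (hs.sum_le_tsum s fun n _ => by positivity).trans ?_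
  rw [← ENNReal.ofReal_le_iff_le_toReal hf.ne, ← he]
  exact le_iSup₂ (f := fun (r : ℝ) (_ : r ∈ Set.Ico (0 : ℝ) 1) =>
    ENNReal.ofReal (1 / (2 * Real.pi)) *
      ∫⁻ t in Set.Ioc 0 (2 * Real.pi), ‖ext0 f (r • expUnit I t)‖ₑ ^ 2) r hr

lemma hardyNormSq_le_tsum {I : imagUnits} {f : unitBall → ℍ[ℝ]} {a : ℕ → ℍ[ℝ]}
    (h : HasSliceExpansion I (ext0 f) a) (ha : Summable fun n => ‖a n‖ ^ 2) :
    hardyNormSq I f ≤ ENNReal.ofReal (∑' n, ‖a n‖ ^ 2) := by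
  refine iSup₂_le fun r hr => ?_
  obtain ⟨hs, he⟩ := h.lintegral_eq hr
  rw [he]
  refine ENNReal.ofReal_le_ofReal (hs.tsum_le_tsum (fun n => ?_) ha)
  have h1 : ‖r ^ n • a n‖ ≤ ‖a n‖ := by
    rw [norm_smul, norm_pow, Real.norm_of_nonneg hr.1]
    exact mul_le_of_le_one_left (norm_nonneg (a n)) (pow_le_one₀ hr.1 hr.2.le)
  gcongr

/-- The Hardy norm is the `ℓ²` norm of the Taylor coefficients. -/
lemma hardyNorm_eq {I : imagUnits} {f : unitBall → ℍ[ℝ]} {a : ℕ → ℍ[ℝ]}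
    (h : HasSliceExpansion I (ext0 f) a) (ha : Summable fun n => ‖a n‖ ^ 2) :
    hardyNorm I f = Real.sqrt (∑' n, ‖a n‖ ^ 2) := by
  have hle := hardyNormSq_le_tsum h ha
  have hnn : 0 ≤ ∑' n, ‖a n‖ ^ 2 := tsum_nonneg fun n => by positivity
  rw [hardyNorm]
  congr 1
  exact le_antisymm (ENNReal.toReal_le_of_le_ofReal hnn hle)
    (Real.tsum_le_of_sum_le (fun n => by positivity)
      (sum_norm_sq_le_hardyNormSq h (hle.trans_lt ENNReal.ofReal_lt_top)))

/-! ### Radial limits -/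

lemma integrable_comp_circleParam {I : imagUnits} (g : L2Circle I) :
    IntegrableOn (fun t => (g : sliceCircle (I : ℍ[ℝ]) → ℍ[ℝ]) (circleParam I t))
      (Set.Ioc 0 (2 * Real.pi)) := by
  have hc : ENNReal.ofReal (1 / (2 * Real.pi)) ≠ 0 := by
    simpa using Real.pi_pos
  have h : Integrable (g : sliceCircle (I : ℍ[ℝ]) → ℍ[ℝ]) (arcMeasure I) :=
    (Lp.memLp g).integrable one_le_two
  replace h := (integrable_smul_measure hc ENNReal.ofReal_ne_top).1 h
  exact (integrable_map_measure h.aestronglyMeasurable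
    (continuous_circleParam I).aemeasurable).1 h

/-- The series of a function in `H²₊(𝕋_I)` may be integrated term by term. -/
lemma tendsto_integral_sum_monomial {I : imagUnits} {a : ℕ → ℍ[ℝ]} {g : L2Circle I}
    (hg : HasSum (fun k => monomial I k (a k)) g) {t : ℝ} (ht : t ∈ Set.Icc 0 (2 * Real.pi)) :
    Tendsto (fun N : ℕ => ∑ k ∈ Finset.range N, ∫ s in 0..t, expUnit I (k * s) * a k) atTop
      (𝓝 (∫ s in 0..t, (g : sliceCircle (I : ℍ[ℝ]) → ℍ[ℝ]) (circleParam I s))) := by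
  set ν := volume.restrict (Set.Ioc 0 (2 * Real.pi)) with hν
  have hcont : ∀ N : ℕ, Continuous fun ζ : sliceCircle (I : ℍ[ℝ]) =>
      ∑ k ∈ Finset.range N, (ζ : ℍ[ℝ]) ^ k * a k := fun N => by fun_prop
  have hL1 : Tendsto (fun N : ℕ => eLpNorm (fun ζ : sliceCircle (I : ℍ[ℝ]) =>
      (∑ k ∈ Finset.range N, (ζ : ℍ[ℝ]) ^ k * a k) - g ζ) 1 (arcMeasure I)) atTop (𝓝 0) := by
    have h2 := (Lp.tendsto_Lp_iff_tendsto_eLpNorm' _ _).1 hg.tendsto_sum_nat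
    refine tendsto_of_tendsto_of_tendsto_of_le_of_le tendsto_const_nhds h2 (fun _ => zero_le)
      fun N => ?_
    refine (eLpNorm_le_eLpNorm_of_exponent_le one_le_two
      ((hcont N).aestronglyMeasurable.sub (Lp.aestronglyMeasurable g))).trans (le_of_eq ?_)
    refine eLpNorm_congr_ae ?_
    filter_upwards [coeFn_sum_monomial I a (Finset.range N)] with ζ hζ
    exact congrArg (· - g ζ) hζ.symm
  have hL1' : Tendsto (fun N : ℕ => eLpNorm ((fun s : ℝ =>
      ∑ k ∈ Finset.range N, expUnit I s ^ k * a k) -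
      fun s => (g : sliceCircle (I : ℍ[ℝ]) → ℍ[ℝ]) (circleParam I s)) 1 ν) atTop (𝓝 0) := by
    have h3 := ENNReal.Tendsto.const_mul (a := ENNReal.ofReal (2 * Real.pi)) hL1
      (Or.inr ENNReal.ofReal_ne_top)
    rw [mul_zero] at h3
    refine h3.congr fun N => ?_
    rw [eLpNorm_one_eq_lintegral_enorm, eLpNorm_one_eq_lintegral_enorm, lintegral_arcMeasure I
      (F := fun ζ => ‖(∑ k ∈ Finset.range N, (ζ : ℍ[ℝ]) ^ k * a k) - g ζ‖ₑ)
      ((hcont N).aestronglyMeasurable.sub (Lp.aestronglyMeasurable g)).enorm, ← mul_assoc,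
      ← ENNReal.ofReal_mul (by positivity), mul_one_div_cancel (by positivity),
      ENNReal.ofReal_one, one_mul]
    rfl
  have hE := continuous_expUnit (I : ℍ[ℝ])
  have h := tendsto_setIntegral_of_L1' (μ := ν)
    (fun s => (g : sliceCircle (I : ℍ[ℝ]) → ℍ[ℝ]) (circleParam I s))
    (integrable_comp_circleParam g).aestronglyMeasurable
    (F := fun (N : ℕ) s => ∑ k ∈ Finset.range N, expUnit I s ^ k * a k)
    (Eventually.of_forall fun N =>
      (Continuous.integrableOn_Icc (by fun_prop)).mono_set Set.Ioc_subset_Icc_self)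
    hL1' (Set.Ioc 0 t)
  have hν2 : ν.restrict (Set.Ioc 0 t) = volume.restrict (Set.Ioc 0 t) := by
    rw [hν, Measure.restrict_restrict measurableSet_Ioc,
      Set.inter_eq_left.2 (Set.Ioc_subset_Ioc_right ht.2)]
  rw [hν2] at h
  simp only [← intervalIntegral.integral_of_le ht.1] at h
  refine h.congr fun N => ?_
  rw [intervalIntegral.integral_finsetSum
    fun k _ => Continuous.intervalIntegrable (by fun_prop) _ _]
  simp only [expUnit_pow]

lemma summable_inv_mul_norm {a : ℕ → ℍ[ℝ]} (ha : Summable fun n => ‖a n‖ ^ 2) :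
    Summable fun n : ℕ => (n : ℝ)⁻¹ * ‖a n‖ := by
  have h2 : Summable fun n : ℕ => ((n : ℝ) ^ 2)⁻¹ := Real.summable_nat_pow_inv.2 one_lt_two
  refine Summable.of_nonneg_of_le (fun n => by positivity) (fun n => ?_) (ha.add h2)
  have := sq_nonneg ((n : ℝ)⁻¹ - ‖a n‖)
  have h3 : 0 ≤ (n : ℝ)⁻¹ * ‖a n‖ := by positivity
  rw [← inv_pow]
  nlinarith

/-- **Fatou's theorem** for `H²`: the radial limits exist almost everywhere and form the
boundary function with the same coefficients. -/
theorem ae_tendsto_radial {I : imagUnits} {a : ℕ → ℍ[ℝ]} (ha : Summable fun n => ‖a n‖ ^ 2)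
    {g : L2Circle I} (hg : HasSum (fun k => monomial I k (a k)) g) {F : ℍ[ℝ] → ℍ[ℝ]}
    (hF : HasSliceExpansion I F a) :
    ∀ᵐ ζ : sliceCircle (I : ℍ[ℝ]) ∂arcMeasure I,
      Tendsto (fun r : ℝ => F (r • (ζ : ℍ[ℝ]))) (𝓝[<] 1) (𝓝 (g ζ)) := by
  let := sliceNormedSpace I
  have := isScalarTower_slice I
  have hsmul : ∀ (z : ℂ) (q : ℍ[ℝ]), z • q = sliceHom I z * q := fun _ _ => rfl
  have hexp : ∀ (k : ℕ) (t : ℝ), sliceHom I (Complex.exp (k * t * Complex.I)) =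
      expUnit I (k * t) := fun k t => by
    rw [← sliceHom_exp]
    push_cast
    rfl
  -- The coefficients of a primitive of `g - a 0`; the term `n = 0` vanishes because `0⁻¹ = 0`.
  set b : ℕ → ℍ[ℝ] := fun n => (Complex.I * n : ℂ)⁻¹ • a n with hb
  have hbs : Summable fun n => ‖b n‖ := by
    refine (summable_inv_mul_norm ha).congr fun n => ?_
    rw [hb, norm_smul]
    simp
  set G : ℝ → ℍ[ℝ] := fun t => ∑' n : ℕ, Complex.exp (n * t * Complex.I) • b n with hG
  have hGs : ∀ t : ℝ, Summable fun n : ℕ => Complex.exp (n * t * Complex.I) • b n := fun t =>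
    Summable.of_norm (by simpa only [norm_smul, norm_exp_nat_mul_I, one_mul] using hbs)
  have hterm : ∀ (k : ℕ) (t : ℝ), ∫ s in 0..t, expUnit I (k * s) * a k =
      (if k = 0 then t • a 0 else 0) +
        (Complex.exp (k * t * Complex.I) • b k - Complex.exp (k * (0 : ℝ) * Complex.I) • b k) := by
    intro k t
    rcases eq_or_ne k 0 with rfl | hk
    · simp [expUnit, slicePt]
    · have hk' : (Complex.I * k : ℂ) ≠ 0 := by simp [hk]
      have hL := ((ContinuousLinearMap.toSpanSingleton ℂ (a k)).restrictScalars
        ℝ).intervalIntegral_comp_comm (Continuous.intervalIntegrable (μ := volume)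
        (by fun_prop : Continuous fun s : ℝ => Complex.exp (Complex.I * k * s)) 0 t)
      simp only [ContinuousLinearMap.coe_restrictScalars',
        ContinuousLinearMap.toSpanSingleton_apply] at hL
      rw [integral_exp_mul_complex hk'] at hL
      have e : ∀ s : ℝ, expUnit I (k * s) * a k = Complex.exp (Complex.I * k * s) • a k := by
        intro s
        rw [hsmul, ← hexp]
        ring_nf
      simp only [e, hL, hk, if_false, zero_add, hb]
      rw [smul_smul, smul_smul, ← sub_smul]
      congr 1
      rw [div_eq_mul_inv, sub_mul]
      ring_nf
  have hprim : ∀ t ∈ Set.Icc 0 (2 * Real.pi),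
      G t = (∫ s in 0..t, (g : sliceCircle (I : ℍ[ℝ]) → ℍ[ℝ]) (circleParam I s)) -
        t • a 0 + G 0 := by
    intro t ht
    have h1 := tendsto_integral_sum_monomial hg ht
    simp only [hterm] at h1
    have h2 := ((hasSum_ite_eq (0 : ℕ) (t • a 0)).add
      ((hGs t).hasSum.sub (hGs 0).hasSum)).tendsto_sum_nat
    rw [tendsto_nhds_unique h1 h2]
    abel
  have hLeb := ((intervalIntegrable_iff_integrableOn_Ioc_of_le Real.two_pi_pos.le).2
    (integrable_comp_circleParam g)).ae_hasDerivAt_integral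
  rw [ae_arcMeasure_iff, ae_restrict_iff' measurableSet_Ioc]
  -- `G` is only known to be a primitive on `[0, 2π]`, so the endpoint `2π` is discarded.
  have hne : ∀ᵐ t : ℝ, t ≠ 2 * Real.pi := by simp [ae_iff, measure_singleton]
  filter_upwards [hLeb, hne] with t hder htne ht
  have htIoo : t ∈ Set.Ioo 0 (2 * Real.pi) := ⟨ht.1, lt_of_le_of_ne ht.2 htne⟩
  rw [Set.uIcc_of_le Real.two_pi_pos.le] at hder
  have hd := hder ⟨ht.1.le, ht.2⟩ 0 ⟨le_rfl, Real.two_pi_pos.le⟩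
  have hDG : HasDerivAt G
      ((g : sliceCircle (I : ℍ[ℝ]) → ℍ[ℝ]) (circleParam I t) - a 0) t := by
    have h1 := ((hd.sub ((hasDerivAt_id t).smul_const (a 0))).add_const (G 0))
    rw [one_smul] at h1
    refine h1.congr_of_eventuallyEq ?_
    filter_upwards [isOpen_Ioo.mem_nhds htIoo] with s hs
    exact hprim s ⟨hs.1.le, hs.2.le⟩
  have hlim := (tendsto_abel_of_hasDerivAt hbs hDG).add_const (a 0)
  rw [sub_add_cancel] at hlim
  refine hlim.congr' ?_
  filter_upwards [Ico_mem_nhdsLT (zero_lt_one (α := ℝ))] with r hr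
  have hFs := hF.hasSum_circle hr (circleParam I t)
  have hrest := hFs.sub (hasSum_ite_eq (0 : ℕ) (a 0))
  have e : ∀ n : ℕ, (Complex.I * n * r ^ n * Complex.exp (n * t * Complex.I)) • b n =
      ((circleParam I t : sliceCircle (I : ℍ[ℝ])) : ℍ[ℝ]) ^ n * (r ^ n • a n) -
        (if n = 0 then a 0 else 0) := by
    intro n
    rcases eq_or_ne n 0 with rfl | hn
    · simp
    · have hn' : (Complex.I * n : ℂ) ≠ 0 := by simp [hn]
      have e1 : ((circleParam I t : sliceCircle (I : ℍ[ℝ])) : ℍ[ℝ]) ^ n = expUnit I (n * t) :=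
        expUnit_pow I t n
      rw [e1, if_neg hn, sub_zero, mul_smul_comm, ← hexp, ← hsmul, hb, smul_smul, ← smul_assoc,
        Complex.real_smul]
      congr 1
      push_cast
      field_simp
  simp only [e]
  rw [hrest.tsum_eq, sub_add_cancel]

/-! ### The boundary value map -/

lemma exists_coefficients {I : imagUnits} {f : unitBall → ℍ[ℝ]} (hf : f ∈ hardyBall I) :
    ∃ a : ℕ → ℍ[ℝ], (Summable fun n => ‖a n‖ ^ 2) ∧ HasSliceExpansion I (ext0 f) a := by
  obtain ⟨a, ha⟩ := (hf.1.2 I I.2).exists_hasSum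
  exact ⟨a, summable_of_sum_le (fun n => by positivity) (sum_norm_sq_le_hardyNormSq ha hf.2), ha⟩

/-- Every square summable sequence is the sequence of coefficients of a function in `H²(𝔹_I)`. -/
lemma exists_mem_hardyBall (I : imagUnits) {a : ℕ → ℍ[ℝ]} (ha : Summable fun n => ‖a n‖ ^ 2) :
    ∃ f ∈ hardyBall I, HasSliceExpansion I (ext0 f) a := by
  set f : unitBall → ℍ[ℝ] := fun q => ∑' n, (q : ℍ[ℝ]) ^ n * a n with hfdef
  have hC : ∀ n, ‖a n‖ ≤ Real.sqrt (∑' n, ‖a n‖ ^ 2) := fun n =>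
    Real.le_sqrt_of_sq_le (ha.le_tsum n fun m _ => by positivity)
  have hsum : ∀ q ∈ unitBall, HasSum (fun n => q ^ n * a n) (ext0 f q) := by
    intro q hq
    have h1 : ext0 f q = ∑' n, q ^ n * a n := by simp only [ext0, hq, dif_pos, hfdef]
    rw [h1]
    refine (Summable.of_norm_bounded (g := fun n => ‖q‖ ^ n * Real.sqrt (∑' n, ‖a n‖ ^ 2))
      ?_ (norm_pow_mul_le hC q)).hasSum
    exact (summable_geometric_of_lt_one (norm_nonneg q) (mem_ball_zero_iff.1 hq)).mul_right _
  have hexp : HasSliceExpansion I (ext0 f) a := fun z hz =>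
    hsum _ ((sliceHom_mem_unitBall I).2 hz)
  exact ⟨f, ⟨isSliceRegularOn_of_hasSum hC hsum,
    (hardyNormSq_le_tsum hexp ha).trans_lt ENNReal.ofReal_lt_top⟩, hexp⟩

/-- The Hardy norm on the single slice `ℂ_I` separates the functions on the whole ball. -/
lemma eq_zero_of_hardyNorm_eq_zero {I : imagUnits} {f : unitBall → ℍ[ℝ]} (hf : f ∈ hardyBall I)
    (h : hardyNorm I f = 0) : f = 0 := by
  obtain ⟨a, ha, hexp⟩ := exists_coefficients hf
  rw [hardyNorm_eq hexp ha, Real.sqrt_eq_zero (tsum_nonneg fun n => by positivity)] at h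
  have h0 : ∀ n, a n = 0 := fun n => by
    have h1 : ‖a n‖ ^ 2 ≤ 0 := h ▸ ha.le_tsum n fun m _ => by positivity
    exact norm_eq_zero.1 (pow_eq_zero_iff two_ne_zero |>.1 (le_antisymm h1 (by positivity)))
  have heq := hf.1.1.eqOn_unitBall isSliceRegularOn_zero.1 I fun z hz => by
    have := hexp z hz
    simp only [h0, mul_zero] at this
    exact this.unique hasSum_zero
  funext q
  simpa [ext0] using heq q.2

/-- The radial limits of `f` form an element of `H²₊(𝕋_I)` of the same norm. -/
lemma exists_boundary {I : imagUnits} (f : hardyBall I) :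
    ∃ g : hardyCircle I, (∀ᵐ ζ ∂arcMeasure I, HasRadialLimit f ζ ((g : L2Circle I) ζ)) ∧
      ‖g‖ = hardyNorm I f := by
  obtain ⟨a, ha, hexp⟩ := exists_coefficients f.2
  obtain ⟨g, hg⟩ := summable_monomial I ha
  refine ⟨⟨g, a, ha, hg⟩, ae_tendsto_radial ha hg hexp, ?_⟩
  rw [hardyNorm_eq hexp ha, (hasSum_norm_sq_of_hasSum_monomial I hg).tsum_eq,
    Real.sqrt_sq (norm_nonneg g)]
  rfl

lemma eq_of_hasRadialLimit {I : imagUnits} {f : unitBall → ℍ[ℝ]} {g h : hardyCircle I}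
    (hg : ∀ᵐ ζ ∂arcMeasure I, HasRadialLimit f ζ ((g : L2Circle I) ζ))
    (hh : ∀ᵐ ζ ∂arcMeasure I, HasRadialLimit f ζ ((h : L2Circle I) ζ)) : g = h := by
  refine Subtype.ext (Lp.ext ?_)
  filter_upwards [hg, hh] with ζ h1 h2
  exact tendsto_nhds_unique h1 h2

/-- The boundary function `f̂_I` of `f ∈ H²(𝔹_I)`. -/
def boundaryValue {I : imagUnits} (f : hardyBall I) : hardyCircle I := (exists_boundary f).choose

lemma hasRadialLimit_boundaryValue {I : imagUnits} (f : hardyBall I) :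
    ∀ᵐ ζ ∂arcMeasure I, HasRadialLimit f ζ ((boundaryValue f : L2Circle I) ζ) :=
  (exists_boundary f).choose_spec.1

lemma norm_boundaryValue {I : imagUnits} (f : hardyBall I) :
    ‖boundaryValue f‖ = hardyNorm I f :=
  (exists_boundary f).choose_spec.2

/-- Taking boundary functions, as a homomorphism of right `ℍ`-modules. -/
def boundaryMap (I : imagUnits) : hardyBall I →ₗ[ℍ[ℝ]ᵐᵒᵖ] hardyCircle I where
  toFun := boundaryValue
  map_add' f g := by
    refine eq_of_hasRadialLimit (hasRadialLimit_boundaryValue (f + g)) ?_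
    filter_upwards [hasRadialLimit_boundaryValue f, hasRadialLimit_boundaryValue g,
      Lp.coeFn_add (boundaryValue f : L2Circle I) (boundaryValue g : L2Circle I)] with ζ h1 h2 h3
    rw [Submodule.coe_add, Submodule.coe_add, h3]
    simpa only [HasRadialLimit, ext0_add] using! h1.add h2
  map_smul' c f := by
    refine eq_of_hasRadialLimit (hasRadialLimit_boundaryValue (c • f)) ?_
    filter_upwards [hasRadialLimit_boundaryValue f,
      Lp.coeFn_smul c (boundaryValue f : L2Circle I)] with ζ h1 h2
    rw [RingHom.id_apply, Submodule.coe_smul, Submodule.coe_smul, h2]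
    simpa only [HasRadialLimit, ext0_smul] using! h1.const_smul c

lemma boundaryMap_bijective (I : imagUnits) : Function.Bijective (boundaryMap I) := by
  refine ⟨(injective_iff_map_eq_zero _).2 fun f hf => ?_, fun g => ?_⟩
  · refine Subtype.ext (eq_zero_of_hardyNorm_eq_zero f.2 ?_)
    rw [← norm_boundaryValue, show boundaryValue f = 0 from hf, norm_zero]
  · obtain ⟨a, ha, hg⟩ := g.2
    obtain ⟨f, hf, hexp⟩ := exists_mem_hardyBall I ha
    exact ⟨⟨f, hf⟩, eq_of_hasRadialLimit (hasRadialLimit_boundaryValue ⟨f, hf⟩)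
      (ae_tendsto_radial ha hg hexp)⟩

end

end SliceHardy

theorem mainTheorem5 (I : SliceHardy.imagUnits) :
    (∀ f : SliceHardy.hardyBall I, ∀ᵐ ζ ∂(SliceHardy.arcMeasure I),
      ∃ L : ℍ[ℝ], SliceHardy.HasRadialLimit f ζ L) ∧
    ∃ Φ : SliceHardy.hardyBall I ≃ₗ[ℍ[ℝ]ᵐᵒᵖ] SliceHardy.hardyCircle I,
      (∀ f : SliceHardy.hardyBall I, ∀ᵐ ζ ∂(SliceHardy.arcMeasure I),
        SliceHardy.HasRadialLimit f ζ ((Φ f : SliceHardy.L2Circle I) ζ)) ∧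
      ∀ f : SliceHardy.hardyBall I, ‖Φ f‖ = SliceHardy.hardyNorm I f := by
  refine ⟨fun f => ?_, LinearEquiv.ofBijective (SliceHardy.boundaryMap I)
    (SliceHardy.boundaryMap_bijective I), SliceHardy.hasRadialLimit_boundaryValue,
    SliceHardy.norm_boundaryValue⟩
  filter_upwards [SliceHardy.hasRadialLimit_boundaryValue f] with ζ h
  exact ⟨_, h⟩
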